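/- Let $n\ge 1$ and let $\Sigma$ be the fan in $\mathbb{R}^n$ (with lattice $\mathbb{Z}^n$) of a projective toric variety, smooth or not; that is, $\Sigma$ is the outer normal fan of a full-dimensional lattice polytope. Let $A\subset\mathbb{Z}^n$ be the set of primitive generators of the rays of $\Sigma$. For nonzero coefficients $c=(c_\alpha)_{\alpha\in A}$ put $W_\Sigma=\sum_{\alpha\in A}c_\alpha z^\alpha$, a Laurent polynomial on $(\mathbb{C}^*)^n$. Let $\operatorname{Log}(z)=(\log|z_1|,\dots,\log|z_n|)$ and let $\theta_j$ be the argument of $z_j$. A toric Kähler form on $(\mathbb{C}^*)^n$ (a Kähler form for the standard complex structure invariant under the standard $T^n$-action) is called *radial* if it equals $\omega_\varphi=\sum_j d\left(\frac{\partial\varphi}{\partial u_j}\right)\wedge d\theta_j$, $u=\operatorname{Log}(z)$, for a smooth strictly convex function $\varphi\colon\mathbb{R}^n\to\mathbb{R}$ with nondegenerate Hessian whose Legendre transform $\Phi=\nabla\varphi$ is a bijection of $\mathbb{R}^n$ that takes rays to rays outside of a compact set. A *monomial division* for $W_\Sigma$ and a map $\mu\colon(\mathbb{C}^*)^n\to\mathbb{R}^n$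 is a family of closed sets $C_\alpha\subset\mathbb{R}^n$ ($\alpha\in A$) such that 1. the $C_\alpha$ cover the complement of a compact subset of $\mathbb{R}^n$; 2. there are constants $k_\alpha>0$ such that for every $z\in(\mathbb{C}^*)^n$ the maximum $\max_{\alpha\in A}|c_\alpha z^\alpha|^{k_\alpha}$ is achieved by some $\alpha$ with $\mu(z)\in C_\alpha$. It is *adapted to $\Sigma$* if for each $\alpha\in A$ there is a compact subset $K_\alpha$ of $\mu^{-1}(C_\alpha)$ such that $\mu(\mu^{-1}(C_\alpha)\setminus K_\alpha)$ is contained in the interior of the star of $\alpha$, the union of the cones of $\Sigma$ containing $\alpha$. Then there is a radial toric Kähler form $\omega_\varphi$ on $(\mathbb{C}^*)^n$, with moment map $\mu=\Phi\circ\operatorname{Log}$, such that for every choice of nonzero coefficients $(c_\alpha)_{\alpha\in A}$ the superpotential $W_\Sigma$ admits, for this $\mu$, a monomial division adapted to $\Sigma$. -/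

import Mathlib

noncomputable section

namespace ToricMirror

/-! ### Fans and projective toric varieties -/

/-- `ℝⁿ` with its standard inner product. The dot product is used to identify `ℝⁿ` with its dual. -/
abbrev Euc (n : ℕ) : Type := EuclideanSpace ℝ (Fin n)

/-- The inclusion of the lattice `ℤⁿ` into `ℝⁿ`. -/
def latticeVec {n : ℕ} (α : Fin n → ℤ) : Euc n := WithLp.toLp 2 (fun i => (α i : ℝ))

/-- The ray `{t α : t ≥ 0}`. -/
def ray {n : ℕ} (α : Fin n → ℤ) : PointedCone ℝ (Euc n) :=
  PointedCone.hull ℝ {latticeVec α}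

/-- A fan in `ℝⁿ` (with respect to the lattice `ℤⁿ`): a finite nonempty collection of strongly convex
rational polyhedral cones, closed under passing to faces, any two of which meet in a common face. -/
structure Fan (n : ℕ) where
  cones : Set (PointedCone ℝ (Euc n))
  finite : cones.Finite
  nonempty : cones.Nonempty
  rational : ∀ σ ∈ cones, ∃ S : Finset (Fin n → ℤ),
    σ = PointedCone.hull ℝ (latticeVec '' (S : Set (Fin n → ℤ)))
  strongly_convex : ∀ σ ∈ cones, ∀ x ∈ σ, -x ∈ σ → x = 0
  face_mem : ∀ σ ∈ cones, ∀ τ : PointedCone ℝ (Euc n), τ.IsFaceOf σ → τ ∈ cones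
  inter_face : ∀ σ ∈ cones, ∀ τ ∈ cones, (σ ⊓ τ).IsFaceOf σ ∧ (σ ⊓ τ).IsFaceOf τ

/-- A lattice vector is primitive if it is not a nontrivial integer multiple of a lattice vector
(in particular it is nonzero). -/
def IsPrimitiveVec {n : ℕ} (α : Fin n → ℤ) : Prop :=
  ∀ (k : ℤ) (β : Fin n → ℤ), α = k • β → IsUnit k

/-- The primitive generators of the rays (one-dimensional cones) of a fan. -/
def Fan.primitiveGenerators {n : ℕ} (F : Fan n) : Set (Fin n → ℤ) :=
  {α | IsPrimitiveVec α ∧ ray α ∈ F.cones}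

theorem IsPrimitiveVec.ne_zero {n : ℕ} {α : Fin n → ℤ} (h : IsPrimitiveVec α) : α ≠ 0 := by
  intro h0
  have := h 0 0 (by simp [h0])
  simp at this

theorem mem_ray {n : ℕ} {α : Fin n → ℤ} {x : Euc n} :
    x ∈ ray α ↔ ∃ t : ℝ, 0 ≤ t ∧ t • latticeVec α = x := by
  unfold ray PointedCone.hull
  rw [Submodule.mem_span_singleton]
  constructor
  · rintro ⟨t, rfl⟩
    exact ⟨t.1, t.2, rfl⟩
  · rintro ⟨t, ht, rfl⟩
    exact ⟨⟨t, ht⟩, rfl⟩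

theorem dvd_of_primitive {n : ℕ} {α β : Fin n → ℤ} (hα : IsPrimitiveVec α) {p q : ℤ}
    (hpq : IsCoprime p q) (h : ∀ i, p * β i = q * α i) : IsUnit p := by
  have hd : ∀ i, p ∣ α i := fun i => hpq.dvd_of_dvd_mul_left ⟨β i, (h i).symm⟩
  choose γ hγ using hd
  exact hα p γ (funext fun i => by simp [hγ i])

theorem ray_injOn {n : ℕ} :
    Set.InjOn (ray : (Fin n → ℤ) → PointedCone ℝ (Euc n)) {α | IsPrimitiveVec α} := by
  intro α hα β hβ h
  have hmem : latticeVec α ∈ ray β := h ▸ mem_ray.2 ⟨1, zero_le_one, one_smul _ _⟩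
  obtain ⟨t, ht, hte⟩ := mem_ray.1 hmem
  have hco : ∀ i, t * (β i : ℝ) = (α i : ℝ) := fun i => by
    have := congrArg (fun x : Euc n => x i) hte
    simpa [latticeVec] using this
  obtain ⟨j, hj⟩ : ∃ j, β j ≠ 0 := Function.ne_iff.1 hβ.ne_zero
  have hj' : (β j : ℝ) ≠ 0 := by exact_mod_cast hj
  set r : ℚ := (α j : ℚ) / β j with hr
  have htr : t = (r : ℝ) := by
    rw [hr]; push_cast; rw [eq_div_iff hj']; exact hco j
  have hden : (r.den : ℤ) ≠ 0 := by exact_mod_cast r.den_ne_zero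
  have hint : ∀ i, r.num * β i = r.den * α i := fun i => by
    have h1 := hco i
    rw [htr] at h1
    have h2 : r * (β i : ℚ) = α i := by exact_mod_cast h1
    have h3 : (r.num : ℚ) = r * r.den := (Rat.mul_den_eq_num r).symm
    have h4 : (r.num : ℚ) * β i = (r.den : ℚ) * α i := by rw [h3, ← h2]; ring
    exact_mod_cast h4
  have hcop : IsCoprime r.num (r.den : ℤ) := Rat.isCoprime_num_den r
  have hp := dvd_of_primitive hα hcop hint
  have hq := dvd_of_primitive hβ hcop.symm (fun i => (hint i).symm)
  have hrnn : 0 ≤ r := by exact_mod_cast htr ▸ ht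
  have hq1 : (r.den : ℤ) = 1 := by
    rcases Int.isUnit_iff.1 hq with h | h
    · exact h
    · omega
  have hp1 : r.num = 1 := by
    have := Rat.num_nonneg.2 hrnn
    rcases Int.isUnit_iff.1 hp with h | h
    · exact h
    · omega
  funext i
  have := hint i
  rw [hq1, hp1] at this
  linarith

theorem Fan.primitiveGenerators_finite {n : ℕ} (F : Fan n) : F.primitiveGenerators.Finite :=
  Set.Finite.of_finite_image (F.finite.subset (by rintro _ ⟨α, hα, rfl⟩; exact hα.2))
    (ray_injOn.mono fun _ hα => hα.1)

/-- The finite set `A` of primitive generators of a fan. -/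
def Fan.gens {n : ℕ} (F : Fan n) : Finset (Fin n → ℤ) := F.primitiveGenerators_finite.toFinset

/-- The star of (the ray generated by) `α`: the union of the cones of the fan that contain `α`. -/
def Fan.star {n : ℕ} (F : Fan n) (α : Fin n → ℤ) : Set (Euc n) :=
  {x | ∃ σ ∈ F.cones, latticeVec α ∈ σ ∧ x ∈ σ}

/-- The cone of outward normal vectors of `P` at `x`. If `P` is a polytope and `x` lies in the relative
interior of its face `Q`, this is the outer normal cone of `Q`. -/
def normalCone {n : ℕ} (P : Set (Euc n)) (x : Euc n) : PointedCone ℝ (Euc n) where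
  carrier := {v | ∀ y ∈ P, inner ℝ v y ≤ inner ℝ v x}
  zero_mem' := by intro y _; simp
  add_mem' := by
    intro a b ha hb y hy
    rw [inner_add_left, inner_add_left]
    exact add_le_add (ha y hy) (hb y hy)
  smul_mem' := by
    rintro ⟨t, ht⟩ a ha y hy
    change inner ℝ (t • a) y ≤ inner ℝ (t • a) x
    rw [real_inner_smul_left, real_inner_smul_left]
    exact mul_le_mul_of_nonneg_left (ha y hy) ht

/-- The fan of a projective toric variety: the fan is the (outer) normal fan of a full-dimensional
lattice polytope `P`, i.e. its cones are the normal cones of the nonempty faces of `P`. Here `P` is the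
polytope of an ample line bundle. -/
def Fan.IsProjective {n : ℕ} (F : Fan n) : Prop :=
  ∃ V : Finset (Fin n → ℤ), ∃ P : Set (Euc n),
    P = convexHull ℝ (latticeVec '' (V : Set (Fin n → ℤ))) ∧
    (interior P).Nonempty ∧
    F.cones = normalCone P '' P

/-! ### The complex torus, Laurent polynomials and `W_Σ` -/

/-- The complex torus `(ℂ*)ⁿ`, an open subset of `ℂⁿ`. -/
def torus (n : ℕ) : Set (Fin n → ℂ) := {z | ∀ j, z j ≠ 0}

/-- `Log z = (log |z₁|, …, log |zₙ|)`. -/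
def Log {n : ℕ} (z : Fin n → ℂ) : Euc n := WithLp.toLp 2 (fun j => Real.log ‖z j‖)

/-- The Laurent monomial `z ^ α`. -/
def monomial {n : ℕ} (α : Fin n → ℤ) (z : Fin n → ℂ) : ℂ := ∏ j, z j ^ α j

/-- Laurent polynomials in `n` variables. -/
abbrev LaurentPoly (n : ℕ) : Type := AddMonoidAlgebra ℂ (Fin n → ℤ)

/-- The Hori-Vafa superpotential `W_Σ = ∑_{α ∈ A} c_α z^α`. -/
def superpotential {n : ℕ} (F : Fan n) (c : (Fin n → ℤ) → ℂ) : LaurentPoly n :=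
  ∑ α ∈ F.gens, AddMonoidAlgebra.single α (c α)

/-! ### Toric Kähler forms -/

/-- Differential 2-forms on `ℂⁿ`; only their restriction to the torus is used. -/
abbrev TwoForm (n : ℕ) : Type := (Fin n → ℂ) → (Fin n → ℂ) [⋀^Fin 2]→L[ℝ] ℝ

/-- The wedge product of two real covectors. -/
def wedge {n : ℕ} (f g : (Fin n → ℂ) →L[ℝ] ℝ) : (Fin n → ℂ) [⋀^Fin 2]→L[ℝ] ℝ :=
  ContinuousMultilinearMap.alternatization
    ((ContinuousMultilinearMap.mkPiAlgebra ℝ (Fin 2) ℝ).compContinuousLinearMap ![f, g])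

theorem wedge_apply {n : ℕ} (f g : (Fin n → ℂ) →L[ℝ] ℝ) (v w : Fin n → ℂ) :
    wedge f g ![v, w] = f v * g w - f w * g v := by
  have huniv : (Finset.univ : Finset (Equiv.Perm (Fin 2))) = {1, Equiv.swap 0 1} := by decide
  have hne : (1 : Equiv.Perm (Fin 2)) ≠ Equiv.swap 0 1 := by decide
  simp [wedge, ContinuousMultilinearMap.alternatization_apply_apply, Fin.prod_univ_two, huniv,
    Finset.sum_pair hne, sub_eq_add_neg]

/-- The covector `dθ_j = Im (dz_j / z_j)` at `z`. -/
def dTheta {n : ℕ} (z : Fin n → ℂ) (j : Fin n) : (Fin n → ℂ) →L[ℝ] ℝ :=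
  Complex.imCLM.comp
    (((z j)⁻¹ • ContinuousLinearMap.proj (R := ℂ) (φ := fun _ : Fin n => ℂ) j).restrictScalars ℝ)

theorem dTheta_apply {n : ℕ} (z v : Fin n → ℂ) (j : Fin n) :
    dTheta z j v = (v j / z j).im := by
  simp [dTheta, div_eq_inv_mul]

/-- `Φ ∘ Log`, where `Φ`, the gradient of `φ`, is the Legendre transform of `φ`. -/
def momentMap {n : ℕ} (φ : Euc n → ℝ) (z : Fin n → ℂ) : Euc n := gradient φ (Log z)

/-- `ω_φ = ∑_j d(∂φ/∂u_j) ∧ dθ_j`, where `u = Log z` and `θ_j` is the argument of `z_j`. -/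
def kahlerForm {n : ℕ} (φ : Euc n → ℝ) : TwoForm n := fun z =>
  ∑ j, wedge (fderiv ℝ (fun y => momentMap φ y j) z) (dTheta z j)

/-- `ω` is a Kähler form on `(ℂ*)ⁿ` for the standard complex structure, invariant under the standard
action of the compact torus `Tⁿ`. -/
structure IsToricKahlerForm {n : ℕ} (ω : TwoForm n) : Prop where
  smooth : ContDiffOn ℝ ((⊤ : ℕ∞) : WithTop ℕ∞) ω (torus n)
  closed : ∀ z ∈ torus n, extDeriv ω z = 0
  compatible : ∀ z ∈ torus n, ∀ v w : Fin n → ℂ,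
    ω z ![Complex.I • v, Complex.I • w] = ω z ![v, w]
  positive : ∀ z ∈ torus n, ∀ v : Fin n → ℂ, v ≠ 0 → 0 < ω z ![v, Complex.I • v]
  invariant : ∀ t : Fin n → ℂ, (∀ j, ‖t j‖ = 1) → ∀ z ∈ torus n, ∀ v w : Fin n → ℂ,
    ω (t * z) ![t * v, t * w] = ω z ![v, w]

/-- `μ` is a moment map for the `Tⁿ`-action and `ω`, with the sign convention `ι_X ω = -dH`.
The vector field `∂/∂θ_j` takes the value `i z_j e_j` at `z`. -/
structure IsMomentMap {n : ℕ} (ω : TwoForm n) (μ : (Fin n → ℂ) → Euc n) : Prop where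
  smooth : ContDiffOn ℝ ((⊤ : ℕ∞) : WithTop ℕ∞) μ (torus n)
  invariant : ∀ t : Fin n → ℂ, (∀ j, ‖t j‖ = 1) → ∀ z ∈ torus n, μ (t * z) = μ z
  hamiltonian : ∀ z ∈ torus n, ∀ (j : Fin n) (w : Fin n → ℂ),
    ω z ![Pi.single j (Complex.I * z j), w] = -(fderiv ℝ μ z w) j

/-- The conditions on the potential `φ` of a radial form: `φ` is smooth and strictly convex with
nondegenerate Hessian, and its gradient is a bijection of `ℝⁿ` that takes rays (from the origin) to
rays outside of a compact set. -/
structure IsRadialPotential {n : ℕ} (φ : Euc n → ℝ) : Prop where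
  smooth : ContDiff ℝ ((⊤ : ℕ∞) : WithTop ℕ∞) φ
  strictConvex : StrictConvexOn ℝ Set.univ φ
  hessian_nondegenerate : ∀ u, Function.Injective (fderiv ℝ (fderiv ℝ φ) u)
  bijective : Function.Bijective (gradient φ)
  rays_to_rays : ∃ K : Set (Euc n), IsCompact K ∧ ∀ u ∉ K, ∀ t : ℝ, 0 < t → t • u ∉ K →
    ∃ s : ℝ, 0 < s ∧ gradient φ (t • u) = s • gradient φ u

/-- `ω` is a radial toric Kähler form on `(ℂ*)ⁿ` with potential `φ`. -/
def IsRadialWith {n : ℕ} (ω : TwoForm n) (φ : Euc n → ℝ) : Prop :=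
  IsToricKahlerForm ω ∧ IsRadialPotential φ ∧ ∀ z ∈ torus n, ω z = kahlerForm φ z

/-! ### Monomial divisions -/

/-- The sets `C α` (`α` an exponent occurring in `W`) form a monomial division for `W` and `μ`. -/
structure IsMonomialDivision {n : ℕ} (W : LaurentPoly n) (μ : (Fin n → ℂ) → Euc n)
    (C : (Fin n → ℤ) → Set (Euc n)) : Prop where
  closed : ∀ α ∈ W.coeff.support, IsClosed (C α)
  cover : ∃ K : Set (Euc n), IsCompact K ∧ ∀ x ∉ K, ∃ α ∈ W.coeff.support, x ∈ C α
  max_achieved : ∃ k : (Fin n → ℤ) → ℝ, (∀ α ∈ W.coeff.support, 0 < k α) ∧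
    ∀ z ∈ torus n, ∃ α ∈ W.coeff.support, μ z ∈ C α ∧ ∀ β ∈ W.coeff.support,
      ‖W.coeff β * monomial β z‖ ^ k β ≤ ‖W.coeff α * monomial α z‖ ^ k α

/-- The division is adapted to the fan: for each `α ∈ A`, the complement in `μ⁻¹(C α)` of some compact
subset is mapped by `μ` into the interior of the star of `α`. -/
def IsAdapted {n : ℕ} (F : Fan n) (μ : (Fin n → ℂ) → Euc n)
    (C : (Fin n → ℤ) → Set (Euc n)) : Prop :=
  ∀ α ∈ F.gens, ∃ K : Set (Fin n → ℂ), IsCompact K ∧ K ⊆ torus n ∩ μ ⁻¹' C α ∧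
    μ '' ((torus n ∩ μ ⁻¹' C α) \ K) ⊆ interior (F.star α)

end ToricMirror

end

/-!
The torus `(ℂ*)ⁿ` is `ℝⁿ × Tⁿ` through `Log`, so the theorem asks for a convex potential `φ` on `ℝⁿ`
whose gradient carries the region where the monomial of exponent `α` dominates into the open star of
`α`, far from the origin.

Let `P` be the polytope of the fan, moved so that the origin is an interior point. It is cut out by
inequalities `⟪α, ·⟫ ≤ b α` with `b α > 0`, one for each primitive generator
(`Fan.IsProjective.exists_supports`; this rests on `Fan.le_hull_gens`: each cone is generated by the
primitive generators that it contains, because the rays through a minimal generating set are faces).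
With `vα = α / b α`, the gauge of `P` is `g u = maxα ⟪vα, u⟫`. The gradient of `g² / 2` exists only as
a subgradient: at `u` it is `g u` times the convex hull of the `vα` that are maximal at `u`, and these
generate the normal cone of the face of `P` containing `u / g u`. So a potential close to `g² / 2`
should do, with the exponents `k α = 1 / b α` in the monomial division: `k α ⟪α, u⟫ = ⟪vα, u⟫`.

The gauge is smoothed by the perspective of log-sum-exp, `f u = t log ∑ exp (⟪vα, u⟫ / t)` at the
temperature `t = δ ‖u‖`, where the norm is replaced near the origin by a positive smooth convex
function (`smoothNorm`). By Gibbs' inequality (`sum_add_entropy_le`) `f` lies above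
`∑ wα ⟪vα, ·⟫ + t H(w)` for all probability weights `w`, with equality at the point whose Gibbs weights
are `w`. As the entropy `H(w)` is nonnegative, these minorants are convex; hence `f` is convex, and its
gradient can be read off from the minorant (`hasGradientAt_softGauge`). The potential is
`φ = f² / 2 + δ ‖u‖² / 2`. It is strongly convex, so its gradient is a closed bijection of `ℝⁿ`, and
homogeneous of degree two outside a ball, so its gradient takes rays to rays there. The form `ω_φ` is
closed since it is the exterior derivative of `∑ μ_j dθ_j`, and its remaining properties follow from
its expression through the Hessian of `φ` in logarithmic coordinates (`kahlerForm_apply`).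

Far out, `∇φ(u) / f(u) = ∑ wα vα + O(δ)`. The Gibbs weights satisfy `∑ wα (g - ⟪vα, u⟫) = O(δ ‖u‖)`, and
`wα` is bounded below if `⟪vα, u⟫ ≥ g u - δ ‖u‖`. If `∇φ(u)` lay in a cone avoiding `α` for arbitrarily
small `δ`, one would find in the limit a direction and weights that charge `α` and are concentrated on
maximal generators, such that `∑ wα vα` lies both in a cone `σ` containing these generators and in a
cone `τ` avoiding `α`. But `σ ∩ τ` is a face of `σ`, so it would contain `α`
(`Fan.IsProjective.exists_pos_le_defect`, `Fan.IsProjective.eventually_gradient_mem_star`). The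
coefficients `c α` change `k α log |c α z^α|` only by bounded amounts, which far from the origin are
smaller than `δ ‖u‖`; so one `δ` serves for all choices of coefficients.
-/

noncomputable section

namespace ToricMirror

open scoped InnerProductSpace

/-! ### Log-sum-exp and the Gibbs variational principle -/

section LogSumExp

variable {ι : Type*} [Fintype ι]

/-- The function `log ∑ᵢ exp xᵢ`. -/
def logSumExp (x : ι → ℝ) : ℝ := Real.log (∑ i, Real.exp (x i))

/-- The probability weights proportional to `exp xᵢ`. -/
def softmax (x : ι → ℝ) (i : ι) : ℝ := Real.exp (x i - logSumExp x)

/-- The Shannon entropy `-∑ᵢ wᵢ log wᵢ`. -/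
def entropy (w : ι → ℝ) : ℝ := ∑ i, Real.negMulLog (w i)

theorem softmax_pos (x : ι → ℝ) (i : ι) : 0 < softmax x i := Real.exp_pos _

variable [Nonempty ι]

theorem exp_logSumExp (x : ι → ℝ) : Real.exp (logSumExp x) = ∑ i, Real.exp (x i) :=
  Real.exp_log (Finset.sum_pos (fun _ _ => Real.exp_pos _) Finset.univ_nonempty)

theorem sum_softmax (x : ι → ℝ) : ∑ i, softmax x i = 1 := by
  simp_rw [softmax, Real.exp_sub]
  rw [← Finset.sum_div, exp_logSumExp, div_self]
  rw [← exp_logSumExp]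
  positivity

theorem le_logSumExp (x : ι → ℝ) (i : ι) : x i ≤ logSumExp x := by
  rw [← Real.exp_le_exp, exp_logSumExp]
  exact Finset.single_le_sum (f := fun i => Real.exp (x i)) (fun j _ => (Real.exp_pos _).le)
    (Finset.mem_univ i)

theorem logSumExp_le {x : ι → ℝ} {M : ℝ} (h : ∀ i, x i ≤ M) :
    logSumExp x ≤ M + Real.log (Fintype.card ι) := by
  have hN : (0 : ℝ) < Fintype.card ι := by exact_mod_cast Fintype.card_pos
  rw [← Real.exp_le_exp, exp_logSumExp, Real.exp_add, Real.exp_log hN]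
  calc ∑ i, Real.exp (x i) ≤ ∑ _i : ι, Real.exp M :=
        Finset.sum_le_sum fun i _ => Real.exp_le_exp.2 (h i)
    _ = Real.exp M * Fintype.card ι := by simp [mul_comm]

theorem softmax_le_one (x : ι → ℝ) (i : ι) : softmax x i ≤ 1 := by
  rw [softmax, Real.exp_le_one_iff, sub_nonpos]
  exact le_logSumExp x i

theorem entropy_softmax_nonneg (x : ι → ℝ) : 0 ≤ entropy (softmax x) :=
  Finset.sum_nonneg fun i _ => Real.negMulLog_nonneg (softmax_pos x i).le (softmax_le_one x i)

/-- Gibbs' inequality: the log-sum-exp of `x` bounds the mean of `x` plus the entropy, for any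
positive probability weights. -/
theorem sum_add_entropy_le (x w : ι → ℝ) (hw : ∀ i, 0 < w i) (h1 : ∑ i, w i = 1) :
    ∑ i, w i * x i + entropy w ≤ logSumExp x := by
  have h := convexOn_exp.map_sum_le (t := Finset.univ) (w := w)
    (p := fun i => x i - Real.log (w i)) (fun i _ => (hw i).le) h1 (fun i _ => Set.mem_univ _)
  rw [← Real.exp_le_exp, exp_logSumExp]
  have h2 : ∑ i, w i • (x i - Real.log (w i)) = ∑ i, w i * x i + entropy w := by
    simp only [entropy, Real.negMulLog, smul_eq_mul, ← Finset.sum_add_distrib]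
    exact Finset.sum_congr rfl fun i _ => by ring
  rw [h2] at h
  refine h.trans_eq (Finset.sum_congr rfl fun i _ => ?_)
  rw [Real.exp_sub, Real.exp_log (hw i), smul_eq_mul, mul_div_cancel₀ _ (hw i).ne']

/-- The case of equality in Gibbs' inequality. -/
theorem sum_softmax_add_entropy (x : ι → ℝ) :
    ∑ i, softmax x i * x i + entropy (softmax x) = logSumExp x := by
  have : entropy (softmax x) = ∑ i, softmax x i * (logSumExp x - x i) := by
    refine Finset.sum_congr rfl fun i _ => ?_
    rw [Real.negMulLog]
    conv_lhs => rw [softmax, Real.log_exp]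
    rw [softmax]; ring
  rw [this, ← Finset.sum_add_distrib]
  simp_rw [← mul_add, add_sub_cancel]
  rw [← Finset.sum_mul, sum_softmax, one_mul]

theorem entropy_softmax_le (x : ι → ℝ) : entropy (softmax x) ≤ Real.log (Fintype.card ι) := by
  have h := sum_add_entropy_le (fun _ => 0) (softmax x) (softmax_pos x) (sum_softmax x)
  simpa [logSumExp] using h

theorem contDiff_logSumExp {n : WithTop ℕ∞} : ContDiff ℝ n (logSumExp : (ι → ℝ) → ℝ) := by
  refine ContDiff.log (by fun_prop) fun x => ?_
  rw [← exp_logSumExp]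
  positivity

end LogSumExp

/-! ### A smooth convex function equal to the norm outside a ball -/

section SmoothNorm

/-- A smooth convex function on `ℝ` that is a positive constant on `(-∞, 1]` and the identity on
`[2, ∞)`. -/
def smoothRamp (x : ℝ) : ℝ := 2 + ∫ s in (2 : ℝ)..x, Real.smoothTransition (s - 1)

theorem hasDerivAt_smoothRamp (x : ℝ) :
    HasDerivAt smoothRamp (Real.smoothTransition (x - 1)) x := by
  have hc : Continuous fun s : ℝ => Real.smoothTransition (s - 1) :=
    Real.smoothTransition.continuous.comp (continuous_id.sub continuous_const)
  exact (intervalIntegral.integral_hasDerivAt_right (hc.intervalIntegrable _ _)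
    (hc.stronglyMeasurableAtFilter _ _) hc.continuousAt).const_add 2

theorem deriv_smoothRamp : deriv smoothRamp = fun x => Real.smoothTransition (x - 1) :=
  funext fun x => (hasDerivAt_smoothRamp x).deriv

theorem contDiff_smoothRamp : ContDiff ℝ ((⊤ : ℕ∞) : WithTop ℕ∞) smoothRamp := by
  rw [contDiff_infty_iff_deriv, deriv_smoothRamp]
  exact ⟨fun x => (hasDerivAt_smoothRamp x).differentiableAt,
    Real.smoothTransition.contDiff.comp (contDiff_id.sub contDiff_const)⟩

theorem monotone_smoothRamp : Monotone smoothRamp :=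
  monotone_of_deriv_nonneg (fun x => (hasDerivAt_smoothRamp x).differentiableAt) fun x => by
    rw [deriv_smoothRamp]; exact Real.smoothTransition.nonneg _

theorem convexOn_smoothRamp : ConvexOn ℝ Set.univ smoothRamp := by
  refine Monotone.convexOn_univ_of_deriv (fun x => (hasDerivAt_smoothRamp x).differentiableAt) ?_
  rw [deriv_smoothRamp]
  exact fun x y h => Real.smoothTransition.monotone (by linarith)

theorem lipschitzWith_smoothRamp : LipschitzWith 1 smoothRamp := by
  refine lipschitzWith_of_nnnorm_deriv_le
    (fun x => (hasDerivAt_smoothRamp x).differentiableAt) fun x => ?_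
  rw [deriv_smoothRamp, ← NNReal.coe_le_coe, coe_nnnorm, NNReal.coe_one, Real.norm_eq_abs,
    abs_of_nonneg (Real.smoothTransition.nonneg _)]
  exact Real.smoothTransition.le_one _

theorem smoothRamp_of_two_le {x : ℝ} (hx : 2 ≤ x) : smoothRamp x = x := by
  have : ∫ s in (2 : ℝ)..x, Real.smoothTransition (s - 1) = ∫ _s in (2 : ℝ)..x, (1 : ℝ) := by
    refine intervalIntegral.integral_congr fun s hs => ?_
    rw [Set.uIcc_of_le hx] at hs
    exact Real.smoothTransition.one_of_one_le (by linarith [hs.1])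
  rw [smoothRamp, this]
  simp

theorem smoothRamp_of_le_one {x : ℝ} (hx : x ≤ 1) : smoothRamp x = smoothRamp 1 := by
  have h : ∀ s ∈ Set.uIcc x 1, Real.smoothTransition (s - 1) = 0 := fun s hs => by
    rw [Set.uIcc_of_le hx] at hs
    exact Real.smoothTransition.zero_of_nonpos (by linarith [hs.2])
  have := intervalIntegral.integral_eq_sub_of_hasDerivAt
    (fun s _ => hasDerivAt_smoothRamp s) (a := x) (b := 1)
    ((Real.smoothTransition.continuous.comp
      (continuous_id.sub continuous_const)).intervalIntegrable _ _)
  rw [intervalIntegral.integral_congr (g := fun _ => 0) h] at this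
  simp at this
  linarith

theorem smoothRamp_pos (x : ℝ) : 0 < smoothRamp x := by
  have h1 : 1 ≤ smoothRamp 1 := by
    have h := convexOn_smoothRamp.slope_le_of_hasDerivAt (Set.mem_univ 1) (Set.mem_univ 2)
      one_lt_two (hasDerivAt_smoothRamp 2)
    have h2 := Real.smoothTransition.le_one ((2 : ℝ) - 1)
    rw [slope_def_field, smoothRamp_of_two_le le_rfl] at h
    norm_num at h h2
    linarith
  rcases le_total x 1 with hx | hx
  · rw [smoothRamp_of_le_one hx]; linarith
  · linarith [monotone_smoothRamp hx]

variable {E : Type*} [NormedAddCommGroup E]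

/-- A smooth convex positive function that equals the norm outside the ball of radius `2`. -/
def smoothNorm (u : E) : ℝ := smoothRamp ‖u‖

theorem smoothNorm_pos (u : E) : 0 < smoothNorm u := smoothRamp_pos _

theorem smoothNorm_of_two_le {u : E} (hu : 2 ≤ ‖u‖) : smoothNorm u = ‖u‖ :=
  smoothRamp_of_two_le hu

variable [InnerProductSpace ℝ E]

theorem contDiff_smoothNorm : ContDiff ℝ ((⊤ : ℕ∞) : WithTop ℕ∞) (smoothNorm : E → ℝ) := by
  rw [contDiff_iff_contDiffAt]
  intro u
  by_cases hu : u = 0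
  · have : (smoothNorm : E → ℝ) =ᶠ[nhds u] fun _ => smoothRamp 1 := by
      filter_upwards [Metric.ball_mem_nhds u one_pos] with v hv
      exact smoothRamp_of_le_one (by simpa [hu] using (Metric.mem_ball.1 hv).le)
    exact contDiffAt_const.congr_of_eventuallyEq this
  · exact contDiff_smoothRamp.contDiffAt.comp u (contDiffAt_norm ℝ hu)

theorem convexOn_smoothNorm : ConvexOn ℝ Set.univ (smoothNorm : E → ℝ) :=
  ⟨convex_univ, fun _ _ _ _ _ _ ha hb hab =>
    (monotone_smoothRamp ((convexOn_norm convex_univ).2 trivial trivial ha hb hab)).trans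
      (convexOn_smoothRamp.2 trivial trivial ha hb hab)⟩

theorem norm_gradient_smoothNorm_le [CompleteSpace E] (u : E) : ‖gradient smoothNorm u‖ ≤ 1 := by
  rw [← (InnerProductSpace.toDual ℝ E).norm_map, toDual_gradient]
  have h := norm_fderiv_le_of_lipschitz ℝ (x₀ := u) (lipschitzWith_smoothRamp.comp
    (lipschitzWith_one_norm (E := E)))
  rwa [mul_one, NNReal.coe_one] at h

end SmoothNorm

/-! ### Gradients of strongly convex functions -/

section StrongConvex

variable {E : Type*} [NormedAddCommGroup E] [InnerProductSpace ℝ E] [CompleteSpace E]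

/-- A convex function lies above its tangent hyperplanes. -/
theorem add_inner_le_of_convexOn {ψ : E → ℝ} (hψ : ConvexOn ℝ Set.univ ψ) {g x : E}
    (hg : HasGradientAt ψ g x) (y : E) : ψ x + ⟪g, y - x⟫_ℝ ≤ ψ y := by
  have hl : ConvexOn ℝ Set.univ fun s : ℝ => ψ (AffineMap.lineMap x y s) :=
    hψ.comp_affineMap (AffineMap.lineMap x y)
  have hd : HasDerivAt (fun s : ℝ => ψ (AffineMap.lineMap x y s)) ⟪g, y - x⟫_ℝ 0 := by
    have h1 : HasDerivAt (AffineMap.lineMap x y : ℝ → E) (y - x) 0 :=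
      AffineMap.hasDerivAt_lineMap
    have h2 : HasFDerivAt ψ (InnerProductSpace.toDual ℝ E g) (AffineMap.lineMap x y (0 : ℝ)) := by
      simpa using hg.hasFDerivAt
    exact h2.comp_hasDerivAt (0 : ℝ) h1
  have := hl.le_slope_of_hasDerivAt (Set.mem_univ 0) (Set.mem_univ 1) one_pos hd
  simp [slope_def_field] at this
  linarith

variable {m : ℝ} {φ : E → ℝ} (hφ : StrongConvexOn Set.univ m φ) (hd : Differentiable ℝ φ)

include hφ hd

theorem StrongConvexOn.add_inner_add_le (x y : E) :
    φ x + ⟪gradient φ x, y - x⟫_ℝ + m / 2 * ‖y - x‖ ^ 2 ≤ φ y := by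
  have hc := strongConvexOn_iff_convex.1 hφ
  have hg : HasGradientAt (fun x => φ x - m / 2 * ‖x‖ ^ 2) (gradient φ x - m • x) x := by
    rw [hasGradientAt_iff_hasFDerivAt]
    have h1 : HasFDerivAt φ (InnerProductSpace.toDual ℝ E (gradient φ x)) x :=
      (hd x).hasGradientAt.hasFDerivAt
    have h2 := (hasStrictFDerivAt_norm_sq x).hasFDerivAt.const_mul (m / 2)
    refine (h1.sub h2).congr_fderiv ?_
    ext v
    simp
    ring
  have h := add_inner_le_of_convexOn hc hg y
  have e := norm_sub_sq_real y x
  rw [inner_sub_left, real_inner_smul_left, inner_sub_right x, real_inner_self_eq_norm_sq] at h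
  rw [e, real_inner_comm x y]
  linarith

theorem StrongConvexOn.gradient_monotone (x y : E) :
    m * ‖x - y‖ ^ 2 ≤ ⟪gradient φ x - gradient φ y, x - y⟫_ℝ := by
  have h1 := StrongConvexOn.add_inner_add_le hφ hd x y
  have h2 := StrongConvexOn.add_inner_add_le hφ hd y x
  rw [← neg_sub x y, inner_neg_right, norm_neg] at h1
  rw [inner_sub_left]
  linarith

theorem StrongConvexOn.mul_norm_sub_le (x y : E) :
    m * ‖x - y‖ ≤ ‖gradient φ x - gradient φ y‖ := by
  rcases eq_or_lt_of_le (norm_nonneg (x - y)) with h | h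
  · rw [← h]; simp
  · have h1 := (StrongConvexOn.gradient_monotone hφ hd x y).trans (real_inner_le_norm _ _)
    rw [pow_two, ← mul_assoc] at h1
    exact le_of_mul_le_mul_right h1 h

variable (hm : 0 < m)

include hm

theorem StrongConvexOn.gradient_injective : Function.Injective (gradient φ) := by
  intro x y hxy
  have h := StrongConvexOn.mul_norm_sub_le hφ hd x y
  rw [hxy, sub_self, norm_zero] at h
  have : ‖x - y‖ ≤ 0 := by
    by_contra hc
    push Not at hc
    nlinarith
  exact sub_eq_zero.1 (norm_le_zero_iff.1 this)

theorem StrongConvexOn.isClosedMap_gradient [FiniteDimensional ℝ E] (h1 : ContDiff ℝ 1 φ) :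
    IsClosedMap (gradient φ) := by
  have hanti : AntilipschitzWith (Real.toNNReal m⁻¹) (gradient φ) :=
    AntilipschitzWith.of_le_mul_dist fun x y => by
      rw [Real.coe_toNNReal _ (inv_nonneg.2 hm.le), dist_eq_norm, dist_eq_norm, le_inv_mul_iff₀ hm]
      exact StrongConvexOn.mul_norm_sub_le hφ hd x y
  have hcont : Continuous (gradient φ) :=
    (InnerProductSpace.toDual ℝ E).symm.continuous.comp (h1.continuous_fderiv (by simp))
  have := FiniteDimensional.proper ℝ E
  refine (isProperMap_iff_tendsto_cocompact.2 ⟨hcont, ?_⟩).isClosedMap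
  rw [← Metric.cobounded_eq_cocompact]
  exact hanti.tendsto_cobounded

/-- The gradient of a strongly convex function is onto: `y` is the gradient at the point that
minimizes `φ - ⟪y, ·⟫`. -/
theorem StrongConvexOn.gradient_surjective [FiniteDimensional ℝ E] :
    Function.Surjective (gradient φ) := by
  intro y
  have hc : Continuous fun x => φ x - ⟪y, x⟫_ℝ := hd.continuous.sub (by fun_prop)
  obtain ⟨x, hx⟩ := hc.exists_forall_le_of_isBounded 0 (by
    refine (Metric.isBounded_closedBall (x := (0 : E))
      (r := 2 * ‖gradient φ 0 - y‖ / m)).subset fun x hx => ?_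
    have h1 := StrongConvexOn.add_inner_add_le hφ hd 0 x
    have h2 := neg_le_of_abs_le (abs_real_inner_le_norm (gradient φ 0 - y) x)
    simp only [Set.mem_ofPred_eq, inner_zero_right, sub_zero] at hx h1
    rw [inner_sub_left] at h2
    rw [mem_closedBall_zero_iff, le_div_iff₀ hm]
    by_contra hlt
    push Not at hlt
    have hx0 : 0 < ‖x‖ := by
      by_contra h0
      have : ‖x‖ = 0 := le_antisymm (not_lt.1 h0) (norm_nonneg x)
      rw [this] at hlt
      nlinarith [norm_nonneg (gradient φ 0 - y)]
    nlinarith)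
  refine ⟨x, ?_⟩
  have hmin : IsLocalMin (fun x => φ x - ⟪y, x⟫_ℝ) x := Filter.Eventually.of_forall hx
  have h0 := hmin.hasFDerivAt_eq_zero
    ((hd x).hasGradientAt.hasFDerivAt.sub (InnerProductSpace.toDual ℝ E y).hasFDerivAt)
  rw [sub_eq_zero] at h0
  exact (InnerProductSpace.toDual ℝ E).injective h0

omit hm in
theorem StrongConvexOn.mul_norm_sq_le_hessian (h2 : ContDiff ℝ 2 φ) (u v : E) :
    m * ‖v‖ ^ 2 ≤ fderiv ℝ (fderiv ℝ φ) u v v := by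
  have hmono : Monotone fun s : ℝ => fderiv ℝ φ (u + s • v) v - s * (m * ‖v‖ ^ 2) := by
    intro s t hst
    rcases eq_or_lt_of_le hst with rfl | hst
    · exact le_rfl
    have h := StrongConvexOn.gradient_monotone hφ hd (u + t • v) (u + s • v)
    have e : (u + t • v) - (u + s • v) = (t - s) • v := by rw [sub_smul]; abel
    rw [e, inner_smul_right, norm_smul, mul_pow, inner_sub_left, inner_gradient_left,
      inner_gradient_left, Real.norm_eq_abs, sq_abs] at h
    have hp : 0 < t - s := sub_pos.2 hst
    have h' : (t - s) * (m * ‖v‖ ^ 2) ≤ fderiv ℝ φ (u + t • v) v - fderiv ℝ φ (u + s • v) v := by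
      refine le_of_mul_le_mul_left ?_ hp
      linarith
    show _ - _ ≤ _ - _
    linarith
  have hdd : DifferentiableAt ℝ (fderiv ℝ φ) u :=
    (h2.fderiv_right (m := 1) (by norm_num)).differentiable (by norm_num) u
  have hder : HasDerivAt (fun s : ℝ => fderiv ℝ φ (u + s • v) v - s * (m * ‖v‖ ^ 2))
      (fderiv ℝ (fderiv ℝ φ) u v v - m * ‖v‖ ^ 2) 0 := by
    have h1 : HasDerivAt (fun s : ℝ => u + s • v) v 0 := by
      simpa using ((hasDerivAt_id (0 : ℝ)).smul_const v).const_add u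
    have h3 : HasFDerivAt (fun x => fderiv ℝ φ x v) ((fderiv ℝ (fderiv ℝ φ) u).flip v)
        (u + (0 : ℝ) • v) := by
      rw [zero_smul, add_zero]
      exact (ContinuousLinearMap.apply ℝ ℝ v).hasFDerivAt.comp u hdd.hasFDerivAt
    have h4 := h3.comp_hasDerivAt (0 : ℝ) h1
    have h5 := (hasDerivAt_id (0 : ℝ)).mul_const (m * ‖v‖ ^ 2)
    rw [one_mul] at h5
    exact h4.sub h5
  have := hmono.deriv_nonneg (x := 0)
  rw [hder.deriv] at this
  linarith

end StrongConvex

/-! ### The smoothed gauge and its potential -/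

section SoftGauge

variable {E : Type*} [NormedAddCommGroup E] [InnerProductSpace ℝ E]

variable {ι : Type*} [Fintype ι]

/-- A smooth approximation of the gauge `u ↦ maxᵢ ⟪vᵢ, u⟫`: the perspective of log-sum-exp, at the
temperature `δ ‖u‖` (smoothed near the origin). It is positively homogeneous outside a ball. -/
def softGauge (v : ι → E) (δ : ℝ) (u : E) : ℝ :=
  δ * smoothNorm u * logSumExp fun i => ⟪v i, u⟫_ℝ / (δ * smoothNorm u)

/-- The Gibbs weights of the linear forms `⟪vᵢ, u⟫`. -/
def gibbsWeight (v : ι → E) (δ : ℝ) (u : E) : ι → ℝ :=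
  softmax fun i => ⟪v i, u⟫_ℝ / (δ * smoothNorm u)

/-- The potential of the radial Kähler form: half the square of the smoothed gauge, made strongly
convex by a multiple of the squared norm. -/
def softPotential (v : ι → E) (δ : ℝ) (u : E) : ℝ :=
  softGauge v δ u ^ 2 / 2 + δ / 2 * ‖u‖ ^ 2

variable [Nonempty ι] {v : ι → E} {δ : ℝ} (hδ : 0 < δ)

include hδ

theorem softGauge_eq (u : E) : softGauge v δ u = ∑ i, gibbsWeight v δ u i * ⟪v i, u⟫_ℝ +
    δ * smoothNorm u * entropy (gibbsWeight v δ u) := by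
  have ht : δ * smoothNorm u ≠ 0 := (mul_pos hδ (smoothNorm_pos u)).ne'
  rw [softGauge, ← sum_softmax_add_entropy, mul_add, Finset.mul_sum]
  congr 1
  refine Finset.sum_congr rfl fun i _ => ?_
  rw [mul_left_comm, mul_div_cancel₀ _ ht]
  rfl

/-- At each point the smoothed gauge has a convex minorant that is a linear form plus a multiple of
the smoothed norm. -/
theorem le_softGauge (u x : E) : ∑ i, gibbsWeight v δ u i * ⟪v i, x⟫_ℝ +
    δ * smoothNorm x * entropy (gibbsWeight v δ u) ≤ softGauge v δ x := by
  have ht : 0 < δ * smoothNorm x := mul_pos hδ (smoothNorm_pos x)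
  have h := mul_le_mul_of_nonneg_left (sum_add_entropy_le
    (fun i => ⟪v i, x⟫_ℝ / (δ * smoothNorm x)) (gibbsWeight v δ u) (softmax_pos _)
    (sum_softmax _)) ht.le
  rw [mul_add, Finset.mul_sum] at h
  refine le_trans (le_of_eq ?_) h
  congr 1
  refine Finset.sum_congr rfl fun i _ => ?_
  rw [mul_left_comm, mul_div_cancel₀ _ ht.ne']

theorem inner_le_softGauge (u : E) (i : ι) : ⟪v i, u⟫_ℝ ≤ softGauge v δ u := by
  have ht : 0 < δ * smoothNorm u := mul_pos hδ (smoothNorm_pos u)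
  have := mul_le_mul_of_nonneg_left
    (le_logSumExp (fun i => ⟪v i, u⟫_ℝ / (δ * smoothNorm u)) i) ht.le
  rwa [mul_div_cancel₀ _ ht.ne'] at this

theorem convexOn_softGauge : ConvexOn ℝ Set.univ (softGauge v δ) := by
  refine ⟨convex_univ, fun x _ y _ a b ha hb hab => ?_⟩
  set u := a • x + b • y
  have hτ := mul_le_mul_of_nonneg_left
    ((convexOn_smoothNorm (E := E)).2 (Set.mem_univ x) (Set.mem_univ y) ha hb hab)
    (mul_nonneg hδ.le (entropy_softmax_nonneg fun i => ⟪v i, u⟫_ℝ / (δ * smoothNorm u)))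
  have hx := mul_le_mul_of_nonneg_left (le_softGauge (v := v) hδ u x) ha
  have hy := mul_le_mul_of_nonneg_left (le_softGauge (v := v) hδ u y) hb
  have e : ∑ i, gibbsWeight v δ u i * ⟪v i, u⟫_ℝ =
      a * ∑ i, gibbsWeight v δ u i * ⟪v i, x⟫_ℝ + b * ∑ i, gibbsWeight v δ u i * ⟪v i, y⟫_ℝ := by
    rw [Finset.mul_sum, Finset.mul_sum, ← Finset.sum_add_distrib]
    refine Finset.sum_congr rfl fun i _ => ?_
    rw [inner_add_right, inner_smul_right, inner_smul_right]
    ring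
  rw [softGauge_eq hδ, e]
  change δ * entropy (gibbsWeight v δ u) * smoothNorm u ≤ _ at hτ
  simp only [smul_eq_mul] at hτ ⊢
  rw [← gibbsWeight] at hτ
  linarith

theorem contDiff_softGauge : ContDiff ℝ ((⊤ : ℕ∞) : WithTop ℕ∞) (softGauge v δ) := by
  have ht : ContDiff ℝ ((⊤ : ℕ∞) : WithTop ℕ∞) fun u : E => δ * smoothNorm u :=
    contDiff_const.mul contDiff_smoothNorm
  refine ht.mul (contDiff_logSumExp.comp (contDiff_pi.2 fun i => ?_))
  exact (contDiff_const.inner ℝ contDiff_id).div ht fun u => (mul_pos hδ (smoothNorm_pos u)).ne'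

omit [Nonempty ι] in
theorem softGauge_smul {s : ℝ} (hs : 0 < s) {u : E} (hu : 2 ≤ ‖u‖) (hsu : 2 ≤ ‖s • u‖) :
    softGauge v δ (s • u) = s * softGauge v δ u := by
  rw [softGauge, softGauge, smoothNorm_of_two_le hu, smoothNorm_of_two_le hsu, norm_smul,
    Real.norm_of_nonneg hs.le]
  have hu0 : ‖u‖ ≠ 0 := by linarith
  have : ∀ i, ⟪v i, s • u⟫_ℝ / (δ * (s * ‖u‖)) = ⟪v i, u⟫_ℝ / (δ * ‖u‖) := fun i => by
    rw [inner_smul_right]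
    field_simp
  simp_rw [this]
  ring

/-- The gradient of the smoothed gauge is that of its convex minorant at the point. -/
theorem hasGradientAt_softGauge [CompleteSpace E] (u : E) : HasGradientAt (softGauge v δ)
    (∑ i, gibbsWeight v δ u i • v i +
      (δ * entropy (gibbsWeight v δ u)) • gradient smoothNorm u) u := by
  have hf : DifferentiableAt ℝ (softGauge v δ) u :=
    (contDiff_softGauge hδ).differentiable (by simp) u
  have hτ : DifferentiableAt ℝ (smoothNorm : E → ℝ) u :=
    contDiff_smoothNorm.differentiable (by simp) u
  set w := gibbsWeight v δ u
  set ℓ : E → ℝ := fun x => ⟪∑ i, w i • v i, x⟫_ℝ + δ * entropy w * smoothNorm x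
  have hℓ : HasFDerivAt ℓ (InnerProductSpace.toDual ℝ E (∑ i, w i • v i) +
      (δ * entropy w) • InnerProductSpace.toDual ℝ E (gradient smoothNorm u)) u :=
    (InnerProductSpace.toDual ℝ E (∑ i, w i • v i)).hasFDerivAt.add
      (hτ.hasGradientAt.hasFDerivAt.const_mul (δ * entropy w))
  have hℓe : ∀ x, ℓ x = ∑ i, w i * ⟪v i, x⟫_ℝ + δ * smoothNorm x * entropy w := fun x => by
    simp only [ℓ, sum_inner, real_inner_smul_left]
    ring
  have hmin : IsLocalMin (fun x => softGauge v δ x - ℓ x) u := by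
    refine Filter.Eventually.of_forall fun x => ?_
    have h1 := le_softGauge (v := v) hδ u x
    have h2 := softGauge_eq (v := v) hδ u
    rw [← hℓe] at h1 h2
    change softGauge v δ u - ℓ u ≤ softGauge v δ x - ℓ x
    linarith
  have h0 := hmin.hasFDerivAt_eq_zero (hf.hasFDerivAt.sub hℓ)
  rw [sub_eq_zero] at h0
  rw [hasGradientAt_iff_hasFDerivAt]
  refine hf.hasFDerivAt.congr_fderiv (h0.trans ?_)
  simp

theorem softGauge_nonneg (hpos : ∀ u ≠ 0, ∃ i, 0 < ⟪v i, u⟫_ℝ) (u : E) :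
    0 ≤ softGauge v δ u := by
  by_cases hu : u = 0
  · have := inner_le_softGauge (v := v) hδ u (Classical.arbitrary ι)
    rwa [hu, inner_zero_right, ← hu] at this
  · obtain ⟨i, hi⟩ := hpos u hu
    exact hi.le.trans (inner_le_softGauge hδ u i)

theorem contDiff_softPotential :
    ContDiff ℝ ((⊤ : ℕ∞) : WithTop ℕ∞) (softPotential v δ) :=
  (((contDiff_softGauge hδ).pow 2).div_const 2).add (contDiff_const.mul (contDiff_norm_sq ℝ))

theorem strongConvexOn_softPotential (hpos : ∀ u ≠ 0, ∃ i, 0 < ⟪v i, u⟫_ℝ) :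
    StrongConvexOn Set.univ δ (softPotential v δ) := by
  rw [strongConvexOn_iff_convex]
  have h := ((convexOn_softGauge (v := v) hδ).pow (fun u _ => softGauge_nonneg hδ hpos u) 2).smul
    (c := (1 / 2 : ℝ)) (by norm_num)
  refine h.congr fun u _ => ?_
  simp [softPotential]
  ring

theorem le_hessian_softPotential [CompleteSpace E] (hpos : ∀ u ≠ 0, ∃ i, 0 < ⟪v i, u⟫_ℝ)
    (u x : E) : δ * ‖x‖ ^ 2 ≤ fderiv ℝ (fderiv ℝ (softPotential v δ)) u x x :=
  StrongConvexOn.mul_norm_sq_le_hessian (strongConvexOn_softPotential hδ hpos)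
    ((contDiff_softPotential hδ).differentiable (by simp))
    (contDiff_infty.1 (contDiff_softPotential hδ) 2) u x

theorem gradient_softPotential [CompleteSpace E] (u : E) : gradient (softPotential v δ) u =
    softGauge v δ u • (∑ i, gibbsWeight v δ u i • v i +
      (δ * entropy (gibbsWeight v δ u)) • gradient smoothNorm u) + δ • u := by
  refine HasGradientAt.gradient ?_
  have h1 := (hasGradientAt_softGauge (v := v) hδ u).hasFDerivAt
  have h2 := (hasStrictFDerivAt_norm_sq u).hasFDerivAt.const_mul (δ / 2)
  have h3 := ((h1.mul h1).mul_const (1 / 2)).add h2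
  rw [hasGradientAt_iff_hasFDerivAt]
  have e : softPotential v δ = fun x => softGauge v δ x * softGauge v δ x * (1 / 2) +
      δ / 2 * ‖x‖ ^ 2 := by
    funext x
    rw [softPotential]
    ring
  rw [e]
  refine h3.congr_fderiv ?_
  ext x
  simp
  ring

theorem gradient_softPotential_smul [CompleteSpace E] {s : ℝ} (hs : 0 < s) {u : E} (hu : 2 < ‖u‖)
    (hsu : 2 < ‖s • u‖) :
    gradient (softPotential v δ) (s • u) = s • gradient (softPotential v δ) u := by
  have hd : Differentiable ℝ (softPotential v δ) :=
    (contDiff_softPotential hδ).differentiable (by simp)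
  have hev : (fun x => softPotential v δ (s • x)) =ᶠ[nhds u]
      fun x => s ^ 2 * softPotential v δ x := by
    have h1 : ∀ᶠ x in nhds u, 2 < ‖x‖ := continuousAt_id.norm.eventually_const_lt hu
    have h2 : ∀ᶠ x in nhds u, 2 < ‖s • x‖ :=
      (continuousAt_id.const_smul s).norm.eventually_const_lt hsu
    filter_upwards [h1, h2] with x hx hsx
    rw [softPotential, softPotential, softGauge_smul hδ hs hx.le hsx.le, norm_smul,
      Real.norm_of_nonneg hs.le]
    ring
  have hl : HasFDerivAt (fun x => softPotential v δ (s • x))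
      ((InnerProductSpace.toDual ℝ E (gradient (softPotential v δ) (s • u))).comp
        (s • ContinuousLinearMap.id ℝ E)) u :=
    (hd (s • u)).hasGradientAt.hasFDerivAt.comp u
      (s • ContinuousLinearMap.id ℝ E).hasFDerivAt
  have hr := (hd u).hasGradientAt.hasFDerivAt.const_mul (s ^ 2)
  have huniq := hl.unique (hr.congr_of_eventuallyEq hev)
  refine ext_inner_right ℝ fun x => ?_
  have := congrArg (fun L : E →L[ℝ] ℝ => L x) huniq
  simp [inner_smul_left] at this ⊢
  have hs' := hs.ne'
  field_simp at this
  exact this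

end SoftGauge

theorem isRadialPotential_softPotential {n : ℕ} {ι : Type*} [Fintype ι] [Nonempty ι]
    {v : ι → Euc n} {δ : ℝ} (hδ : 0 < δ) (hpos : ∀ u ≠ 0, ∃ i, 0 < ⟪v i, u⟫_ℝ) :
    IsRadialPotential (softPotential v δ) where
  smooth := contDiff_softPotential hδ
  strictConvex := (strongConvexOn_softPotential hδ hpos).strictConvexOn hδ
  hessian_nondegenerate u := by
    rw [injective_iff_map_eq_zero]
    intro x hx
    have h := le_hessian_softPotential hδ hpos u x
    rw [hx] at h
    by_contra hne
    have : 0 < δ * ‖x‖ ^ 2 := by positivity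
    simp at h
    linarith
  bijective :=
    have hd := (contDiff_softPotential (v := v) hδ).differentiable (by simp)
    ⟨StrongConvexOn.gradient_injective (strongConvexOn_softPotential hδ hpos) hd hδ,
      StrongConvexOn.gradient_surjective (strongConvexOn_softPotential hδ hpos) hd hδ⟩
  rays_to_rays := by
    refine ⟨Metric.closedBall 0 2, isCompact_closedBall _ _, fun u hu t ht htu => ⟨t, ht, ?_⟩⟩
    rw [mem_closedBall_zero_iff, not_le] at hu htu
    exact gradient_softPotential_smul hδ ht hu htu

/-! ### The Kähler form of a convex potential -/

section KahlerForm

variable {n : ℕ}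

theorem isOpen_torus : IsOpen (torus n) := by
  simp only [torus, Set.ofPred_forall]
  exact isOpen_iInter_of_finite fun j => isOpen_ne_fun (continuous_apply j) continuous_const

/-- The real part of a tangent vector in logarithmic coordinates, `du (v)` for `u = Log`. -/
def logRe (z v : Fin n → ℂ) : Euc n := WithLp.toLp 2 fun j => (v j / z j).re

/-- The imaginary part of a tangent vector in logarithmic coordinates, `dθ (v)`. -/
def logIm (z v : Fin n → ℂ) : Euc n := WithLp.toLp 2 fun j => (v j / z j).im

theorem hasFDerivAt_log_norm {w : ℂ} (hw : w ≠ 0) : HasFDerivAt (fun w : ℂ => Real.log ‖w‖)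
    (Complex.reCLM.comp ((w⁻¹ • ContinuousLinearMap.id ℂ ℂ).restrictScalars ℝ)) w := by
  have hsq : ‖w‖ ^ 2 ≠ 0 := by positivity
  have h := ((hasStrictFDerivAt_norm_sq w).hasFDerivAt.log hsq).const_mul (1 / 2)
  have e : (fun w : ℂ => Real.log ‖w‖) = fun w : ℂ => 1 / 2 * Real.log (‖w‖ ^ 2) := by
    funext w
    rw [Real.log_pow]
    push_cast
    ring
  rw [e]
  refine h.congr_fderiv ?_
  ext x
  have hn : Complex.normSq w ≠ 0 := by simpa using hw
  simp [Complex.inner, Complex.sq_norm, Complex.inv_re, Complex.inv_im]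
  field_simp
  ring

theorem contDiffAt_Log {z : Fin n → ℂ} (hz : z ∈ torus n) {k : WithTop ℕ∞} :
    ContDiffAt ℝ k (Log : (Fin n → ℂ) → Euc n) z := by
  rw [contDiffAt_euclidean]
  intro j
  have h1 : ContDiffAt ℝ k (fun w : ℂ => ‖w‖) (z j) := contDiffAt_norm ℝ (hz j)
  have h2 : ContDiffAt ℝ k (fun z : Fin n → ℂ => z j) z := by fun_prop
  exact (h1.comp z h2).log (norm_ne_zero_iff.2 (hz j))

theorem fderiv_Log {z : Fin n → ℂ} (hz : z ∈ torus n) (v : Fin n → ℂ) :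
    fderiv ℝ (Log : (Fin n → ℂ) → Euc n) z v = logRe z v := by
  ext j
  have h1 : HasFDerivAt (fun z => Log z j) ((EuclideanSpace.proj j : Euc n →L[ℝ] ℝ).comp
      (fderiv ℝ (Log : (Fin n → ℂ) → Euc n) z)) z :=
    (EuclideanSpace.proj j : Euc n →L[ℝ] ℝ).hasFDerivAt.comp z
      ((contDiffAt_Log hz (k := 1)).differentiableAt (by simp)).hasFDerivAt
  have h2 : HasFDerivAt (fun z : Fin n → ℂ => z j)
      (ContinuousLinearMap.proj (R := ℝ) (φ := fun _ : Fin n => ℂ) j) z :=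
    (ContinuousLinearMap.proj (R := ℝ) (φ := fun _ : Fin n => ℂ) j).hasFDerivAt
  have h3 := (hasFDerivAt_log_norm (hz j)).comp z h2
  have := congrArg (fun L : (Fin n → ℂ) →L[ℝ] ℝ => L v) (h1.unique h3)
  simpa [logRe, div_eq_inv_mul] using this

theorem Log_mul {t z : Fin n → ℂ} (ht : ∀ j, ‖t j‖ = 1) : Log (t * z) = Log z := by
  ext j
  simp [Log, ht j]

theorem logRe_I_smul (z v : Fin n → ℂ) : logRe z (Complex.I • v) = -logIm z v := by
  ext j
  simp [logRe, logIm, mul_div_assoc]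

theorem logIm_I_smul (z v : Fin n → ℂ) : logIm z (Complex.I • v) = logRe z v := by
  ext j
  simp [logRe, logIm, mul_div_assoc]

variable {φ : Euc n → ℝ} (hφ : ContDiff ℝ ((⊤ : ℕ∞) : WithTop ℕ∞) φ)

include hφ

theorem contDiff_gradient : ContDiff ℝ ((⊤ : ℕ∞) : WithTop ℕ∞) (gradient φ) :=
  (InnerProductSpace.toDual ℝ (Euc n)).symm.toContinuousLinearEquiv.contDiff.comp
    (hφ.fderiv_right (by simp))

theorem inner_fderiv_gradient (u x y : Euc n) :
    ⟪fderiv ℝ (gradient φ) u x, y⟫_ℝ = fderiv ℝ (fderiv ℝ φ) u x y := by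
  have h1 : HasFDerivAt (fun u => ⟪y, gradient φ u⟫_ℝ)
      ((innerSL ℝ y).comp (fderiv ℝ (gradient φ) u)) u :=
    (innerSL ℝ y).hasFDerivAt.comp u
      ((contDiff_gradient hφ).differentiable (by simp) u).hasFDerivAt
  have h2 : HasFDerivAt (fun u => fderiv ℝ φ u y) ((fderiv ℝ (fderiv ℝ φ) u).flip y) u :=
    (ContinuousLinearMap.apply ℝ ℝ y).hasFDerivAt.comp u
      (((contDiff_infty.1 hφ 2).fderiv_right (m := 1) (by norm_num)).differentiable
        (by simp) u).hasFDerivAt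
  have e : (fun u => ⟪y, gradient φ u⟫_ℝ) = fun u => fderiv ℝ φ u y := by
    funext u
    rw [real_inner_comm, inner_gradient_left]
  rw [e] at h1
  rw [real_inner_comm]
  exact congrArg (fun L : Euc n →L[ℝ] ℝ => L x) (h1.unique h2)

theorem contDiffOn_momentMap :
    ContDiffOn ℝ ((⊤ : ℕ∞) : WithTop ℕ∞) (momentMap φ) (torus n) := fun z hz =>
  ((contDiff_gradient hφ).contDiffAt.comp z (contDiffAt_Log hz)).contDiffWithinAt

theorem hasFDerivAt_momentMap {z : Fin n → ℂ} (hz : z ∈ torus n) : HasFDerivAt (momentMap φ)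
    ((fderiv ℝ (gradient φ) (Log z)).comp (fderiv ℝ Log z)) z :=
  ((contDiff_gradient hφ).differentiable (by simp) (Log z)).hasFDerivAt.comp z
    ((contDiffAt_Log hz (k := 1)).differentiableAt (by simp)).hasFDerivAt

theorem hasFDerivAt_momentMap_apply {z : Fin n → ℂ} (hz : z ∈ torus n) (j : Fin n) :
    HasFDerivAt (fun y => momentMap φ y j) ((EuclideanSpace.proj j : Euc n →L[ℝ] ℝ).comp
      ((fderiv ℝ (gradient φ) (Log z)).comp (fderiv ℝ Log z))) z :=
  (EuclideanSpace.proj j : Euc n →L[ℝ] ℝ).hasFDerivAt.comp z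
    (hasFDerivAt_momentMap hφ hz)

/-- In logarithmic coordinates the form `ω_φ` is `∑ φ_jk du_k ∧ dθ_j`. -/
theorem kahlerForm_apply {z : Fin n → ℂ} (hz : z ∈ torus n) (v w : Fin n → ℂ) :
    kahlerForm φ z ![v, w] =
      fderiv ℝ (fderiv ℝ φ) (Log z) (logRe z v) (logIm z w) -
        fderiv ℝ (fderiv ℝ φ) (Log z) (logRe z w) (logIm z v) := by
  have h : ∀ j (v : Fin n → ℂ), fderiv ℝ (fun y => momentMap φ y j) z v =
      fderiv ℝ (gradient φ) (Log z) (logRe z v) j := fun j v => by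
    rw [(hasFDerivAt_momentMap_apply hφ hz j).fderiv, ← fderiv_Log hz]
    rfl
  rw [← inner_fderiv_gradient hφ, ← inner_fderiv_gradient hφ, kahlerForm,
    ContinuousAlternatingMap.sum_apply]
  simp only [wedge_apply, h, dTheta_apply, PiLp.inner_apply, Finset.sum_sub_distrib]
  simp [logIm, mul_comm]

theorem hessian_symm (u x y : Euc n) :
    fderiv ℝ (fderiv ℝ φ) u x y = fderiv ℝ (fderiv ℝ φ) u y x :=
  ((contDiff_infty.1 hφ 2).contDiffAt.isSymmSndFDerivAt (by simp)).eq x y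

/-- The primitive `∑ μ_j dθ_j` of `ω_φ`, where `μ` is the moment map. -/
def kahlerPrimitive (φ : Euc n → ℝ) (z : Fin n → ℂ) : (Fin n → ℂ) [⋀^Fin 1]→L[ℝ] ℝ :=
  ContinuousAlternatingMap.ofSubsingletonLIE 0 (∑ j, momentMap φ z j • dTheta z j)

omit hφ in
theorem contDiffOn_dTheta (j : Fin n) {k : WithTop ℕ∞} :
    ContDiffOn ℝ k (fun z => dTheta z j) (torus n) := by
  let L : ℂ →ₗ[ℝ] ((Fin n → ℂ) →L[ℝ] ℝ) :=
    { toFun := fun c => Complex.imCLM.comp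
        ((c • ContinuousLinearMap.proj (R := ℂ) (φ := fun _ : Fin n => ℂ) j).restrictScalars ℝ)
      map_add' := fun a b => by ext v; simp [add_mul]
      map_smul' := fun a b => by ext v; simp [mul_assoc] }
  intro z hz
  have h2 : ContDiffAt ℝ k (fun z : Fin n → ℂ => z j) z := by fun_prop
  exact ((LinearMap.toContinuousLinearMap L).contDiff.contDiffAt.comp z
    (h2.inv (hz j))).contDiffWithinAt

theorem contDiffOn_kahlerPrimitive :
    ContDiffOn ℝ ((⊤ : ℕ∞) : WithTop ℕ∞) (kahlerPrimitive φ) (torus n) := by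
  refine (ContinuousAlternatingMap.ofSubsingletonLIE (𝕜 := ℝ) (E := Fin n → ℂ) (F := ℝ)
    (0 : Fin 1)).contDiff.comp_contDiffOn ?_
  refine ContDiffOn.sum fun j _ => ContDiffOn.fun_smul ?_ (contDiffOn_dTheta j)
  exact (EuclideanSpace.proj j : Euc n →L[ℝ] ℝ).contDiff.comp_contDiffOn
    (contDiffOn_momentMap hφ)

omit hφ in
theorem hasFDerivAt_dTheta_apply {z : Fin n → ℂ} (hz : z ∈ torus n) (j : Fin n)
    (w : Fin n → ℂ) : ∃ D : (Fin n → ℂ) →L[ℝ] ℝ,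
      HasFDerivAt (fun y => dTheta y j w) D z ∧ ∀ v, D v = -(v j / z j * (w j / z j)).im := by
  have h1 : HasFDerivAt (fun y : Fin n → ℂ => (y j)⁻¹ * w j)
      (w j • (-(z j ^ 2)⁻¹ • ContinuousLinearMap.proj (R := ℂ) (φ := fun _ : Fin n => ℂ) j)) z := by
    have h2 := (hasDerivAt_inv (hz j)).comp_hasFDerivAt z
      (ContinuousLinearMap.proj (R := ℂ) (φ := fun _ : Fin n => ℂ) j).hasFDerivAt
    exact h2.mul_const (w j)
  refine ⟨_, Complex.imCLM.hasFDerivAt.comp z (h1.restrictScalars ℝ), fun v => ?_⟩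
  have := hz j
  simp only [ContinuousLinearMap.comp_apply, ContinuousLinearMap.coe_restrictScalars',
    smul_apply, ContinuousLinearMap.proj_apply, Complex.imCLM_apply,
    smul_eq_mul, ← Complex.neg_im]
  congr 1
  field_simp

theorem extDeriv_kahlerPrimitive {z : Fin n → ℂ} (hz : z ∈ torus n) :
    extDeriv (kahlerPrimitive φ) z = kahlerForm φ z := by
  have key : ∀ v w : Fin n → ℂ, fderiv ℝ (fun y => kahlerPrimitive φ y ![w]) z v =
      ∑ j, (fderiv ℝ (fun y => momentMap φ y j) z v * dTheta z j w -
        momentMap φ z j * (v j / z j * (w j / z j)).im) := fun v w => by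
    choose D hD hDv using fun j => hasFDerivAt_dTheta_apply hz j w
    have h := HasFDerivAt.fun_sum (u := Finset.univ) fun j _ =>
      (hasFDerivAt_momentMap_apply hφ hz j).fun_mul (hD j)
    have e : (fun y => kahlerPrimitive φ y ![w]) = fun y => ∑ j, momentMap φ y j * dTheta y j w := by
      funext y
      simp [kahlerPrimitive]
    rw [e, h.fderiv]
    simp only [sum_apply, add_apply, smul_apply, hDv, smul_eq_mul]
    exact Finset.sum_congr rfl fun j _ => by
      rw [(hasFDerivAt_momentMap_apply hφ hz j).fderiv]; ring
  have hdiff : DifferentiableAt ℝ (kahlerPrimitive φ) z :=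
    ((contDiffOn_kahlerPrimitive hφ).differentiableOn (by simp)).differentiableAt
      (isOpen_torus.mem_nhds hz)
  ext v
  obtain ⟨a, b, rfl⟩ : ∃ a b, v = ![a, b] := ⟨v 0, v 1, by ext i; fin_cases i <;> rfl⟩
  have r0 : (0 : Fin 2).removeNth ![a, b] = ![b] := by ext i; fin_cases i; rfl
  have r1 : (1 : Fin 2).removeNth ![a, b] = ![a] := by ext i; fin_cases i; rfl
  rw [extDeriv_apply hdiff, Fin.sum_univ_two, r0, r1]
  simp only [Matrix.cons_val_zero, Matrix.cons_val_one, key, kahlerForm,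
    ContinuousAlternatingMap.sum_apply, wedge_apply]
  simp only [Fin.val_zero, Fin.val_one, pow_zero, pow_one, one_smul, neg_smul,
    ← sub_eq_add_neg, ← Finset.sum_sub_distrib]
  exact Finset.sum_congr rfl fun j _ => by rw [mul_comm (b j / z j)]; ring

theorem isToricKahlerForm_kahlerForm
    (hpos : ∀ u x : Euc n, x ≠ 0 → 0 < fderiv ℝ (fderiv ℝ φ) u x x) :
    IsToricKahlerForm (kahlerForm φ) where
  smooth := by
    have h := (contDiffOn_kahlerPrimitive hφ).fderiv_of_isOpen isOpen_torus
      (m := ((⊤ : ℕ∞) : WithTop ℕ∞)) (by simp)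
    refine ((ContinuousAlternatingMap.alternatizeUncurryFinCLM ℝ (Fin n → ℂ)
      ℝ).contDiff.comp_contDiffOn h).congr fun z hz => ?_
    exact (extDeriv_kahlerPrimitive hφ hz).symm
  closed z hz := by
    have hev : kahlerForm φ =ᶠ[nhds z] extDeriv (kahlerPrimitive φ) := by
      filter_upwards [isOpen_torus.mem_nhds hz] with y hy
      exact (extDeriv_kahlerPrimitive hφ hy).symm
    rw [hev.extDeriv_eq]
    exact extDeriv_extDeriv_apply
      ((contDiffOn_infty.1 (contDiffOn_kahlerPrimitive hφ) 2).contDiffAt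
        (isOpen_torus.mem_nhds hz)) (by simp)
  compatible z hz v w := by
    rw [kahlerForm_apply hφ hz, kahlerForm_apply hφ hz, logRe_I_smul, logRe_I_smul,
      logIm_I_smul, logIm_I_smul, hessian_symm hφ _ (logRe z v), hessian_symm hφ _ (logRe z w)]
    simp
    ring
  positive z hz v hv := by
    rw [kahlerForm_apply hφ hz, logRe_I_smul, logIm_I_smul, map_neg,
      neg_apply, sub_neg_eq_add]
    have h0 : ∀ x : Euc n, 0 ≤ fderiv ℝ (fderiv ℝ φ) (Log z) x x := fun x => by
      by_cases hx : x = 0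
      · simp [hx]
      · exact (hpos _ x hx).le
    by_cases hre : logRe z v = 0
    · refine add_pos_of_nonneg_of_pos (h0 _) (hpos _ _ fun him => hv ?_)
      funext j
      have h1 := congrArg (fun x : Euc n => x j) hre
      have h2 := congrArg (fun x : Euc n => x j) him
      have h3 : v j / z j = 0 := Complex.ext h1 h2
      simpa [hz j] using h3
    · exact add_pos_of_pos_of_nonneg (hpos _ _ hre) (h0 _)
  invariant t ht z hz v w := by
    have htj : ∀ j, t j ≠ 0 := fun j => norm_ne_zero_iff.1 (by rw [ht j]; exact one_ne_zero)
    have htz : t * z ∈ torus n := fun j => mul_ne_zero (htj j) (hz j)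
    have hre : ∀ v, logRe (t * z) (t * v) = logRe z v := fun v => by
      ext j
      simp [logRe, mul_div_mul_left _ _ (htj j)]
    have him : ∀ v, logIm (t * z) (t * v) = logIm z v := fun v => by
      ext j
      simp [logIm, mul_div_mul_left _ _ (htj j)]
    rw [kahlerForm_apply hφ hz, kahlerForm_apply hφ htz, Log_mul ht]
    simp only [hre, him]

theorem isMomentMap_momentMap : IsMomentMap (kahlerForm φ) (momentMap φ) where
  smooth := contDiffOn_momentMap hφ
  invariant t ht z _ := by rw [momentMap, momentMap, Log_mul ht]
  hamiltonian z hz j w := by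
    have h1 : logRe z (Pi.single j (Complex.I * z j)) = 0 := by
      ext i
      rcases eq_or_ne i j with rfl | hij
      · simp [logRe, mul_div_assoc, div_self (hz i)]
      · simp [logRe, hij]
    have h2 : logIm z (Pi.single j (Complex.I * z j)) = EuclideanSpace.single j 1 := by
      ext i
      rcases eq_or_ne i j with rfl | hij
      · simp [logIm, mul_div_assoc, div_self (hz i)]
      · simp [logIm, hij]
    rw [kahlerForm_apply hφ hz, h1, h2, (hasFDerivAt_momentMap hφ hz).fderiv,
      ← inner_fderiv_gradient hφ _ (logRe z w), EuclideanSpace.inner_single_right,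
      ContinuousLinearMap.comp_apply, fderiv_Log hz]
    simp

end KahlerForm

/-! ### Cones of a projective fan -/

section FanGeometry

variable {n : ℕ}

theorem exists_primitive_smul {s : Fin n → ℤ} (hs : s ≠ 0) :
    ∃ (d : ℤ) (α : Fin n → ℤ), 0 < d ∧ IsPrimitiveVec α ∧ s = d • α := by
  obtain ⟨j, hj⟩ := Function.ne_iff.1 hs
  obtain ⟨g, hg, hg1⟩ := Finset.extract_gcd s (s := Finset.univ) ⟨j, Finset.mem_univ j⟩
  refine ⟨Finset.univ.gcd s, g, ?_, fun k β hk => ?_, funext fun i => hg i (Finset.mem_univ i)⟩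
  · refine lt_of_le_of_ne ?_ fun h => hj ?_
    · rw [← Finset.normalize_gcd]
      exact Int.nonneg_of_normalize_eq_self (normalize_idem _)
    · rw [hg j (Finset.mem_univ j), ← h, zero_mul]
      rfl
  · rw [isUnit_iff_dvd_one, ← hg1]
    exact Finset.dvd_gcd fun i _ => ⟨β i, congrFun hk i⟩

theorem latticeVec_smul (d : ℤ) (α : Fin n → ℤ) : latticeVec (d • α) = (d : ℝ) • latticeVec α := by
  ext i
  simp [latticeVec]

theorem ray_smul {d : ℤ} (hd : 0 < d) (α : Fin n → ℤ) : ray (d • α) = ray α := by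
  have hd' : (0 : ℝ) < d := by exact_mod_cast hd
  ext x
  rw [mem_ray, mem_ray, latticeVec_smul]
  constructor
  · rintro ⟨t, ht, rfl⟩
    exact ⟨t * d, by positivity, by rw [mul_smul]⟩
  · rintro ⟨t, ht, rfl⟩
    exact ⟨t / d, by positivity, by rw [smul_smul, div_mul_cancel₀ _ hd'.ne']⟩

/-- In a strongly convex cone, a generator that is not generated by the others spans a face. -/
theorem ray_isFaceOf {σ : PointedCone ℝ (Euc n)} (hσ : ∀ x ∈ σ, -x ∈ σ → x = 0)
    {s : Fin n → ℤ} {T : Set (Euc n)} (h : σ = PointedCone.hull ℝ (insert (latticeVec s) T))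
    (hs : latticeVec s ∉ PointedCone.hull ℝ T) : (ray s).IsFaceOf σ := by
  have hTσ : PointedCone.hull ℝ T ≤ σ := h ▸ Submodule.span_mono (Set.subset_insert _ _)
  have hsσ : latticeVec s ∈ σ := h ▸ Submodule.subset_span (Set.mem_insert _ _)
  have hdec : ∀ x ∈ σ, ∃ r : ℝ, 0 ≤ r ∧ ∃ x' ∈ PointedCone.hull ℝ T,
      x = r • latticeVec s + x' := fun x hx => by
    rw [h] at hx
    obtain ⟨r, x', hx', rfl⟩ := Submodule.mem_span_insert.1 hx
    exact ⟨r.1, r.2, x', hx', rfl⟩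
  refine ⟨fun x hx => ?_, fun {x y a} hx hy ha hxy => ?_⟩
  · obtain ⟨t, ht, rfl⟩ := mem_ray.1 hx
    exact PointedCone.smul_mem σ ht hsσ
  · obtain ⟨t, ht, hte⟩ := mem_ray.1 hxy
    obtain ⟨r, hr, x', hx', rfl⟩ := hdec x hx
    obtain ⟨q, hq, y', hy', rfl⟩ := hdec y hy
    have hsum : a • x' + y' = (t - a * r - q) • latticeVec s := by
      rw [sub_smul, sub_smul, hte, smul_add, mul_smul]
      abel
    have hax' := PointedCone.smul_mem _ ha.le hx'
    rcases lt_or_ge 0 (t - a * r - q) with hp | hp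
    · refine absurd ?_ hs
      have := PointedCone.smul_mem _ (inv_nonneg.2 hp.le) (add_mem hax' hy')
      rwa [hsum, smul_smul, inv_mul_cancel₀ hp.ne', one_smul] at this
    · have h0 : a • x' = 0 := by
        refine hσ _ (hTσ hax') ?_
        have := add_mem (hTσ hy') (PointedCone.smul_mem σ (neg_nonneg.2 hp) hsσ)
        rwa [neg_smul, ← hsum, show y' + -(a • x' + y') = -(a • x') by abel] at this
      have hx0 : x' = 0 := (smul_eq_zero.1 h0).resolve_left ha.ne'
      rw [hx0, add_zero]
      exact mem_ray.2 ⟨r, hr, rfl⟩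

theorem Fan.mem_gens {F : Fan n} {α : Fin n → ℤ} :
    α ∈ F.gens ↔ IsPrimitiveVec α ∧ ray α ∈ F.cones := by
  simp [Fan.gens, Fan.primitiveGenerators]

/-- Every cone of a fan is generated by the primitive generators of the rays that it contains. -/
theorem Fan.le_hull_gens (F : Fan n) {σ : PointedCone ℝ (Euc n)} (hσ : σ ∈ F.cones) :
    σ ≤ PointedCone.hull ℝ (latticeVec '' {α | α ∈ F.gens ∧ latticeVec α ∈ σ}) := by
  classical
  obtain ⟨S, hS⟩ := F.rational σ hσ
  -- A minimal generating set consists of generators of rays of the fan.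
  obtain ⟨T, hT, hmin⟩ := wellFounded_lt.has_min
    {T : Finset (Fin n → ℤ) | σ = PointedCone.hull ℝ (latticeVec '' (T : Set (Fin n → ℤ)))} ⟨S, hS⟩
  rw [Set.mem_ofPred_eq] at hT
  conv_lhs => rw [hT]
  refine Submodule.span_le.2 ?_
  rintro _ ⟨s, hs, rfl⟩
  rw [Finset.mem_coe] at hs
  set R : Set (Euc n) := latticeVec '' ((T.erase s : Finset _) : Set (Fin n → ℤ))
  have hins : latticeVec '' (T : Set (Fin n → ℤ)) = insert (latticeVec s) R := by
    rw [← Set.image_insert_eq, ← Finset.coe_insert, Finset.insert_erase hs]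
  rw [hins] at hT
  have hsR : latticeVec s ∉ PointedCone.hull ℝ R := fun hmem =>
    hmin (T.erase s) (hT.trans (Submodule.span_insert_eq_span hmem)) (Finset.erase_ssubset hs)
  have hs0 : s ≠ 0 := by
    rintro rfl
    refine hsR ?_
    convert zero_mem (PointedCone.hull ℝ R)
    ext i
    simp [latticeVec]
  have hsσ : latticeVec s ∈ σ := hT ▸ Submodule.subset_span (Set.mem_insert _ _)
  have hface := F.face_mem σ hσ _ (ray_isFaceOf (F.strongly_convex σ hσ) hT hsR)
  obtain ⟨d, α, hd, hα, rfl⟩ := exists_primitive_smul hs0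
  have hd' : (0 : ℝ) < d := by exact_mod_cast hd
  rw [ray_smul hd] at hface
  rw [latticeVec_smul] at hsσ ⊢
  refine PointedCone.smul_mem _ hd'.le (Submodule.subset_span ⟨α, ⟨Fan.mem_gens.2 ⟨hα, hface⟩, ?_⟩, rfl⟩)
  have := PointedCone.smul_mem σ (inv_nonneg.2 hd'.le) hsσ
  rwa [smul_smul, inv_mul_cancel₀ hd'.ne', one_smul] at this

/-- Linear inequalities on a cone of a fan can be checked on the primitive generators. -/
theorem Fan.inner_le_of_gens (F : Fan n) {σ : PointedCone ℝ (Euc n)} (hσ : σ ∈ F.cones)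
    {y y' : Euc n}
    (h : ∀ α ∈ F.gens, latticeVec α ∈ σ → ⟪latticeVec α, y⟫_ℝ ≤ ⟪latticeVec α, y'⟫_ℝ)
    {x : Euc n} (hx : x ∈ σ) : ⟪x, y⟫_ℝ ≤ ⟪x, y'⟫_ℝ := by
  have hle : PointedCone.hull ℝ (latticeVec '' {α | α ∈ F.gens ∧ latticeVec α ∈ σ}) ≤
      normalCone {y} y' := by
    refine Submodule.span_le.2 ?_
    rintro _ ⟨α, ⟨hα, hασ⟩, rfl⟩ z rfl
    exact h α hα hασ
  exact hle (F.le_hull_gens hσ hx) y rfl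

/-- If a point of `σ ∩ τ` has a positive multiple of `α` as a summand in `σ`, then `τ` contains
`α`, since `σ ∩ τ` is a face of `σ`. -/
theorem Fan.mem_of_smul_add_mem (F : Fan n) {σ τ : PointedCone ℝ (Euc n)} (hσ : σ ∈ F.cones)
    (hτ : τ ∈ F.cones) {x y : Euc n} {c : ℝ} (hc : 0 < c) (hx : x ∈ σ) (hy : y ∈ σ)
    (h : c • x + y ∈ τ) : x ∈ τ :=
  ((F.inter_face σ hσ τ hτ).1.mem_of_smul_add_mem hx hy hc
    ⟨add_mem (PointedCone.smul_mem σ hc.le hx) hy, h⟩).2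

theorem isClosed_normalCone (P : Set (Euc n)) (x : Euc n) :
    IsClosed (normalCone P x : Set (Euc n)) := by
  have : (normalCone P x : Set (Euc n)) = ⋂ y ∈ P, {v | ⟪v, y⟫_ℝ ≤ ⟪v, x⟫_ℝ} := by
    ext v
    simp [normalCone]
  rw [this]
  exact isClosed_biInter fun y _ => isClosed_le (by fun_prop) (by fun_prop)

/-- The union of the cones of the fan that do not contain `α`. -/
def Fan.coStar (F : Fan n) (α : Fin n → ℤ) : Set (Euc n) :=
  ⋃ τ ∈ {τ ∈ F.cones | latticeVec α ∉ τ}, (τ : Set (Euc n))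

theorem Fan.mem_coStar {F : Fan n} {α : Fin n → ℤ} {x : Euc n} :
    x ∈ F.coStar α ↔ ∃ τ ∈ F.cones, latticeVec α ∉ τ ∧ x ∈ τ := by
  simp [Fan.coStar, and_assoc]

theorem Fan.smul_mem_coStar {F : Fan n} {α : Fin n → ℤ} {x : Euc n} {t : ℝ} (ht : 0 ≤ t)
    (hx : x ∈ F.coStar α) : t • x ∈ F.coStar α := by
  obtain ⟨τ, hτ, hα, hx⟩ := Fan.mem_coStar.1 hx
  exact Fan.mem_coStar.2 ⟨τ, hτ, hα, PointedCone.smul_mem τ ht hx⟩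

theorem Fan.isClosed_coStar {F : Fan n} (hF : F.IsProjective) (α : Fin n → ℤ) :
    IsClosed (F.coStar α) := by
  obtain ⟨V, P, hP, hint, hcones⟩ := hF
  refine (F.finite.subset fun τ hτ => hτ.1).isClosed_biUnion fun τ hτ => ?_
  obtain ⟨x, _, rfl⟩ := hcones ▸ hτ.1
  exact isClosed_normalCone P x

theorem Fan.IsProjective.exists_mem_cone {F : Fan n} (hF : F.IsProjective) (x : Euc n) :
    ∃ σ ∈ F.cones, x ∈ σ := by
  obtain ⟨V, P, hP, hint, hcones⟩ := hF
  have hPc : IsCompact P := hP ▸ (V.finite_toSet.image _).isCompact_convexHull ℝ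
  obtain ⟨y, hy, hmax⟩ := hPc.exists_isMaxOn (hint.mono interior_subset)
    (f := fun y => ⟪x, y⟫_ℝ) (by fun_prop)
  exact ⟨normalCone P y, hcones ▸ ⟨y, hy, rfl⟩, fun z hz => hmax hz⟩

theorem Fan.compl_coStar_subset {F : Fan n} (hF : F.IsProjective) (α : Fin n → ℤ) :
    (F.coStar α)ᶜ ⊆ interior (F.star α) := by
  refine interior_maximal (fun x hx => ?_) (Fan.isClosed_coStar hF α).isOpen_compl
  obtain ⟨σ, hσ, hxσ⟩ := hF.exists_mem_cone x
  refine ⟨σ, hσ, ?_, hxσ⟩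
  by_contra h
  exact hx (Fan.mem_coStar.2 ⟨σ, hσ, h, hxσ⟩)

theorem Fan.coStar_nonempty {F : Fan n} (hF : F.IsProjective) {α : Fin n → ℤ} (hα : α ∈ F.gens) :
    (F.coStar α).Nonempty := by
  have hp := (Fan.mem_gens.1 hα).1
  by_contra hempty
  have hall : ∀ τ ∈ F.cones, latticeVec α ∈ τ := fun τ hτ => by
    by_contra h
    exact hempty ⟨0, Fan.mem_coStar.2 ⟨τ, hτ, h, zero_mem τ⟩⟩
  obtain ⟨σ, hσ, hneg⟩ := hF.exists_mem_cone (-latticeVec α)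
  have h0 := F.strongly_convex σ hσ _ (hall σ hσ) hneg
  refine hp.ne_zero (funext fun i => ?_)
  have := congrArg (fun x : Euc n => x i) h0
  simpa [latticeVec] using this

/-- The dual description of the polytope of a projective fan, moved so as to contain the origin in
its interior: it is cut out by one inequality `⟪α, ·⟫ ≤ b α` with `b α > 0` for each primitive
generator. The rescaled generators `vα = α / b α` detect all directions, and those that are maximal
in a given direction lie in a common cone, the normal cone of a face. -/
theorem Fan.IsProjective.exists_supports {F : Fan n} (hF : F.IsProjective) :
    ∃ b : F.gens → ℝ, (∀ i, 0 < b i) ∧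
      (∀ u : Euc n, u ≠ 0 → ∃ i, 0 < ⟪(b i)⁻¹ • latticeVec i.1, u⟫_ℝ) ∧
      ∀ (u : Euc n) (M : ℝ), 0 < M → (∀ i, ⟪(b i)⁻¹ • latticeVec i.1, u⟫_ℝ ≤ M) →
        ∃ σ ∈ F.cones, ∀ i, ⟪(b i)⁻¹ • latticeVec i.1, u⟫_ℝ = M → latticeVec i.1 ∈ σ := by
  have hcomplete := hF.exists_mem_cone
  obtain ⟨V, P, hP, ⟨p, hp⟩, hcones⟩ := hF
  have hPc : IsCompact P := hP ▸ (V.finite_toSet.image _).isCompact_convexHull ℝ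
  have hPconv : Convex ℝ P := hP ▸ convex_convexHull ℝ _
  have hpP : p ∈ P := interior_subset hp
  have hne0 : ∀ i : F.gens, latticeVec i.1 ≠ 0 := fun i h0 => by
    refine (Fan.mem_gens.1 i.2).1.ne_zero (funext fun k => ?_)
    have := congrArg (fun x : Euc n => x k) h0
    simpa [latticeVec] using this
  choose q hqP hq using fun i : F.gens => hPc.exists_isMaxOn ⟨p, hpP⟩
    (f := fun y => ⟪latticeVec i.1, y⟫_ℝ) (by fun_prop)
  have hq' : ∀ i, ∀ y ∈ P, ⟪latticeVec i.1, y⟫_ℝ ≤ ⟪latticeVec i.1, q i⟫_ℝ :=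
    fun i y hy => hq i hy
  set b : F.gens → ℝ := fun i => ⟪latticeVec i.1, q i - p⟫_ℝ with hb
  have hbpos : ∀ i, 0 < b i := fun i => by
    -- A small step from `p` in the direction of the generator stays in the polytope.
    have hcont : Filter.Tendsto (fun t : ℝ => p + t • latticeVec i.1)
        (nhdsWithin 0 (Set.Ioi 0)) (nhds p) := by
      have : Continuous fun t : ℝ => p + t • latticeVec i.1 := by fun_prop
      simpa using (this.tendsto 0).mono_left nhdsWithin_le_nhds
    obtain ⟨t, htP, ht⟩ := ((hcont.eventually (mem_interior_iff_mem_nhds.1 hp)).and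
      self_mem_nhdsWithin).exists
    have h1 := hq' i _ htP
    rw [inner_add_right, inner_smul_right] at h1
    have h2 : 0 < ⟪latticeVec i.1, latticeVec i.1⟫_ℝ := real_inner_self_pos.2 (hne0 i)
    have h3 := mul_pos (Set.mem_Ioi.1 ht) h2
    rw [hb]
    simp only [inner_sub_right]
    linarith
  refine ⟨b, hbpos, fun u hu => ?_, fun u M hM hle => ?_⟩
  · obtain ⟨σ, hσ, huσ⟩ := hcomplete u
    by_contra! hall
    have := F.inner_le_of_gens hσ (y := u) (y' := 0) (fun α hα _ => by
      have h := hall ⟨α, hα⟩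
      rw [real_inner_smul_left] at h
      rw [inner_zero_right]
      by_contra! hlt
      exact absurd h (not_le.2 (mul_pos (inv_pos.2 (hbpos _)) hlt))) huσ
    rw [inner_zero_right] at this
    exact absurd (real_inner_self_pos.2 hu) (not_lt.2 this)
  · set y : Euc n := p + M⁻¹ • u with hy
    have hyi : ∀ i, ⟪latticeVec i.1, y⟫_ℝ = ⟪latticeVec i.1, p⟫_ℝ +
        b i * (M⁻¹ * ⟪(b i)⁻¹ • latticeVec i.1, u⟫_ℝ) := fun i => by
      have := (hbpos i).ne'
      rw [hy, inner_add_right, inner_smul_right, real_inner_smul_left]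
      field_simp
    have hbi : ∀ i, ⟪latticeVec i.1, q i⟫_ℝ = ⟪latticeVec i.1, p⟫_ℝ + b i := fun i => by
      rw [hb]
      simp only [inner_sub_right]
      ring
    have hyle : ∀ i, ⟪latticeVec i.1, y⟫_ℝ ≤ ⟪latticeVec i.1, q i⟫_ℝ := fun i => by
      rw [hyi, hbi]
      have h1 : M⁻¹ * ⟪(b i)⁻¹ • latticeVec i.1, u⟫_ℝ ≤ 1 := by
        rw [inv_mul_le_iff₀ hM, mul_one]
        exact hle i
      have := mul_le_mul_of_nonneg_left h1 (hbpos i).le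
      linarith
    have hyP : y ∈ P := by
      by_contra hyP
      obtain ⟨f, s, hfs, hsy⟩ := geometric_hahn_banach_closed_point hPconv hPc.isClosed hyP
      set w := (InnerProductSpace.toDual ℝ (Euc n)).symm f
      have hw : ∀ x, ⟪w, x⟫_ℝ = f x := fun x => InnerProductSpace.toDual_symm_apply
      obtain ⟨σ, hσ, hwσ⟩ := hcomplete w
      obtain ⟨y', hy'P, rfl⟩ := hcones ▸ hσ
      have := F.inner_le_of_gens hσ (y := y) (y' := y')
        (fun α hα hασ => (hyle ⟨α, hα⟩).trans (hασ _ (hqP ⟨α, hα⟩))) hwσ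
      rw [hw, hw] at this
      linarith [hfs y' hy'P]
    refine ⟨normalCone P y, hcones ▸ ⟨y, hyP, rfl⟩, fun i hi z hz => ?_⟩
    refine (hq' i z hz).trans (le_of_eq ?_)
    rw [hyi, hbi, hi, inv_mul_cancel₀ hM.ne', mul_one]

end FanGeometry

/-! ### The moment map near the chambers of the gauge -/

section Chambers

variable {n : ℕ}

/-- The limiting form of the key estimate. If weights with `w α` bounded below were concentrated on
the generators maximal in the direction `u`, then `∑ wᵢ vᵢ` would lie in a common cone of these
generators and, having a component along `α`, in no cone that avoids `α`. By compactness the two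
conditions fail by a definite amount. -/
theorem Fan.IsProjective.exists_pos_le_defect {F : Fan n} (hF : F.IsProjective) [Nonempty F.gens]
    {b : F.gens → ℝ} (hb : ∀ i, 0 < b i)
    (hpos : ∀ u : Euc n, u ≠ 0 → ∃ i, 0 < ⟪(b i)⁻¹ • latticeVec i.1, u⟫_ℝ)
    (hcone : ∀ (u : Euc n) (M : ℝ), 0 < M → (∀ i, ⟪(b i)⁻¹ • latticeVec i.1, u⟫_ℝ ≤ M) →
        ∃ σ ∈ F.cones, ∀ i, ⟪(b i)⁻¹ • latticeVec i.1, u⟫_ℝ = M → latticeVec i.1 ∈ σ)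
    (α : F.gens) {c : ℝ} (hc : 0 < c) :
    ∃ m > 0, ∀ (w : F.gens → ℝ) (u : Euc n) (M : ℝ), (∀ i, 0 ≤ w i) → ∑ i, w i = 1 → c ≤ w α →
      ‖u‖ = 1 → (∀ i, ⟪(b i)⁻¹ • latticeVec i.1, u⟫_ℝ ≤ M) →
      m ≤ ∑ i, w i * (M - ⟪(b i)⁻¹ • latticeVec i.1, u⟫_ℝ) +
        Metric.infDist (∑ i, w i • ((b i)⁻¹ • latticeVec i.1)) (F.coStar α) := by
  set v : F.gens → Euc n := fun i => (b i)⁻¹ • latticeVec i.1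
  set g : Euc n → ℝ := fun u => Finset.univ.sup' Finset.univ_nonempty fun i => ⟪v i, u⟫_ℝ
  have hgle : ∀ u i, ⟪v i, u⟫_ℝ ≤ g u := fun u i =>
    Finset.le_sup' (fun i => ⟪v i, u⟫_ℝ) (Finset.mem_univ i)
  have hgc : Continuous g := Continuous.finset_sup'_apply _ fun i _ => by fun_prop
  set K : Set ((F.gens → ℝ) × Euc n) :=
    (stdSimplex ℝ F.gens ∩ {w | c ≤ w α}) ×ˢ Metric.sphere 0 1
  have hK : IsCompact K :=
    ((isCompact_stdSimplex ℝ F.gens).inter_right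
      (isClosed_le continuous_const (continuous_apply α))).prod (isCompact_sphere 0 1)
  set G : (F.gens → ℝ) × Euc n → ℝ := fun x => ∑ i, x.1 i * (g x.2 - ⟪v i, x.2⟫_ℝ) +
    Metric.infDist (∑ i, x.1 i • v i) (F.coStar α)
  have hG : Continuous G := by
    refine Continuous.add (by fun_prop) ((Metric.continuous_infDist_pt _).comp (by fun_prop))
  have hGpos : ∀ x ∈ K, 0 < G x := by
    rintro ⟨w, u⟩ ⟨⟨⟨hw0, hw1⟩, hwα⟩, hu⟩
    simp only at hw0 hw1 hwα hu
    have hu1 : u ≠ 0 := by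
      rintro rfl
      simp at hu
    have hterm : ∀ i ∈ Finset.univ, 0 ≤ w i * (g u - ⟪v i, u⟫_ℝ) := fun i _ =>
      mul_nonneg (hw0 i) (sub_nonneg.2 (hgle u i))
    have hsum0 := Finset.sum_nonneg hterm
    have hdist0 : 0 ≤ Metric.infDist (∑ i, w i • v i) (F.coStar α) := Metric.infDist_nonneg
    by_contra hneg
    have hle : ∑ i, w i * (g u - ⟪v i, u⟫_ℝ) +
      Metric.infDist (∑ i, w i • v i) (F.coStar α) ≤ 0 := not_lt.1 hneg
    have hmax : ∀ i, w i = 0 ∨ ⟪v i, u⟫_ℝ = g u := fun i => by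
      have h0 := (Finset.sum_eq_zero_iff_of_nonneg hterm).1 (by linarith) i (Finset.mem_univ i)
      rcases mul_eq_zero.1 h0 with h | h
      · exact Or.inl h
      · exact Or.inr (by linarith)
    have hmem : ∑ i, w i • v i ∈ F.coStar α :=
      ((Fan.isClosed_coStar hF _).mem_iff_infDist_zero (Fan.coStar_nonempty hF α.2)).2
        (by linarith)
    obtain ⟨i₀, hi₀⟩ := hpos u hu1
    obtain ⟨σ, hσ, hσg⟩ := hcone u (g u) (hi₀.trans_le (hgle u i₀)) (hgle u)
    obtain ⟨τ, hτ, hατ, hxτ⟩ := Fan.mem_coStar.1 hmem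
    have hwα0 : 0 < w α := hc.trans_le hwα
    have hασ : latticeVec α.1 ∈ σ := hσg α ((hmax α).resolve_left hwα0.ne')
    classical
    rw [← Finset.add_sum_erase _ _ (Finset.mem_univ α), smul_smul] at hxτ
    refine hατ (F.mem_of_smul_add_mem hσ hτ (mul_pos hwα0 (inv_pos.2 (hb α))) hασ ?_ hxτ)
    refine sum_mem fun i _ => ?_
    rcases hmax i with h | h
    · rw [h, zero_smul]
      exact zero_mem σ
    · exact PointedCone.smul_mem σ (hw0 i)
        (PointedCone.smul_mem σ (inv_nonneg.2 (hb i).le) (hσg i h))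
  obtain ⟨m, hm, hmG⟩ := hK.exists_forall_le' hG.continuousOn hGpos
  refine ⟨m, hm, fun w u M hw0 hw1 hwα hu hM => (hmG (w, u) ⟨⟨⟨hw0, hw1⟩, hwα⟩, by simpa⟩).trans ?_⟩
  have hgM : g u ≤ M := Finset.sup'_le _ _ fun i _ => hM i
  refine add_le_add_left (Finset.sum_le_sum fun i _ => ?_) _
  exact mul_le_mul_of_nonneg_left (by linarith) (hw0 i)

/-- For small `δ` the gradient of the potential maps the directions in which `α` is maximal, up to
an error `δ`, into the open star of `α`. -/
theorem Fan.IsProjective.eventually_gradient_mem_star {F : Fan n} (hF : F.IsProjective)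
    [Nonempty F.gens] {b : F.gens → ℝ} (hb : ∀ i, 0 < b i)
    (hpos : ∀ u : Euc n, u ≠ 0 → ∃ i, 0 < ⟪(b i)⁻¹ • latticeVec i.1, u⟫_ℝ)
    (hcone : ∀ (u : Euc n) (M : ℝ), 0 < M → (∀ i, ⟪(b i)⁻¹ • latticeVec i.1, u⟫_ℝ ≤ M) →
        ∃ σ ∈ F.cones, ∀ i, ⟪(b i)⁻¹ • latticeVec i.1, u⟫_ℝ = M → latticeVec i.1 ∈ σ)
    (α : F.gens) :
    ∀ᶠ δ in nhdsWithin (0 : ℝ) (Set.Ioi 0), ∀ u : Euc n, 2 ≤ ‖u‖ →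
      (∀ i, ⟪(b i)⁻¹ • latticeVec i.1, u⟫_ℝ ≤ ⟪(b α)⁻¹ • latticeVec α.1, u⟫_ℝ + δ * ‖u‖) →
      gradient (softPotential (fun i : F.gens => (b i)⁻¹ • latticeVec i.1) δ) u ∈
        interior (F.star α) := by
  set v : F.gens → Euc n := fun i => (b i)⁻¹ • latticeVec i.1
  set N : ℝ := Real.log (Fintype.card F.gens)
  have hN : 0 ≤ N := Real.log_nonneg (by exact_mod_cast Fintype.card_pos)
  obtain ⟨m, hm, hdefect⟩ := hF.exists_pos_le_defect hb hpos hcone α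
    (c := Real.exp (-1 - N)) (Real.exp_pos _)
  -- The gauge is bounded below by a positive constant on the unit sphere.
  obtain ⟨r, hr, hrle⟩ : ∃ r > 0, ∀ u : Euc n, ‖u‖ = 1 → ∃ i, r ≤ ⟪v i, u⟫_ℝ := by
    obtain ⟨r, hr, hrg⟩ := (isCompact_sphere (0 : Euc n) 1).exists_forall_le'
      (f := fun u => Finset.univ.sup' Finset.univ_nonempty fun i => ⟪v i, u⟫_ℝ) (a := 0)
      (Continuous.finset_sup'_apply _ fun i _ => by fun_prop).continuousOn fun u hu => by
        obtain ⟨i, hi⟩ := hpos u (by rintro rfl; simp at hu)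
        exact hi.trans_le (Finset.le_sup' (fun i => ⟪v i, u⟫_ℝ) (Finset.mem_univ i))
    refine ⟨r, hr, fun u hu => ?_⟩
    obtain ⟨i, _, hi⟩ := (Finset.le_sup'_iff _).1 (hrg u (by simpa using hu))
    exact ⟨i, hi⟩
  have hδm : ∀ᶠ δ in nhdsWithin (0 : ℝ) (Set.Ioi 0), δ * (2 * N + r⁻¹) < m := by
    have hcont : Continuous fun δ : ℝ => δ * (2 * N + r⁻¹) := by fun_prop
    exact ((hcont.tendsto' 0 0 (by simp)).mono_left nhdsWithin_le_nhds).eventually_lt_const hm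
  filter_upwards [hδm, self_mem_nhdsWithin] with δ hδm hδ u hu hα
  rw [Set.mem_Ioi] at hδ
  have hu0 : 0 < ‖u‖ := by linarith
  set w := gibbsWeight v δ u
  set f := softGauge v δ u
  set H := entropy w
  have hw0 : ∀ i, 0 < w i := softmax_pos _
  have hw1 : ∑ i, w i = 1 := sum_softmax _
  have hH0 : 0 ≤ H := entropy_softmax_nonneg _
  have hHN : H ≤ N := entropy_softmax_le _
  have ht : 0 < δ * ‖u‖ := mul_pos hδ hu0
  have hτ : smoothNorm u = ‖u‖ := smoothNorm_of_two_le hu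
  have hf : f = ∑ i, w i * ⟪v i, u⟫_ℝ + δ * ‖u‖ * H := hτ ▸ softGauge_eq hδ u
  set û : Euc n := ‖u‖⁻¹ • u
  have hû : ‖û‖ = 1 := by
    rw [norm_smul, norm_inv, norm_norm, inv_mul_cancel₀ hu0.ne']
  have hinner : ∀ i, ⟪v i, û⟫_ℝ = ‖u‖⁻¹ * ⟪v i, u⟫_ℝ := fun i => inner_smul_right _ _ _
  have hfr : r * ‖u‖ ≤ f := by
    obtain ⟨i, hi⟩ := hrle û hû
    rw [hinner, le_inv_mul_iff₀ hu0, mul_comm] at hi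
    exact hi.trans (inner_le_softGauge hδ u i)
  have hf0 : 0 < f := (mul_pos hr hu0).trans_le hfr
  have hwα : Real.exp (-1 - N) ≤ w α := by
    refine Real.exp_le_exp.2 ?_
    have h := logSumExp_le (x := fun i => ⟪v i, u⟫_ℝ / (δ * smoothNorm u))
      (M := ⟪v α, u⟫_ℝ / (δ * smoothNorm u) + 1) fun i => by
        rw [hτ, div_add_one ht.ne']
        exact div_le_div_of_nonneg_right (hα i) ht.le
    linarith
  have hd := hdefect w û (‖u‖⁻¹ * f) (fun i => (hw0 i).le) hw1 hwα hû fun i => by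
    change ⟪v i, û⟫_ℝ ≤ _
    rw [hinner]
    exact mul_le_mul_of_nonneg_left (inner_le_softGauge hδ u i) (inv_nonneg.2 hu0.le)
  have hsum : ∑ i, w i * (‖u‖⁻¹ * f - ⟪v i, û⟫_ℝ) = δ * H := by
    simp_rw [hinner, mul_sub, Finset.sum_sub_distrib, ← Finset.sum_mul, hw1, mul_left_comm _ ‖u‖⁻¹,
      ← Finset.mul_sum, one_mul]
    rw [hf]
    field_simp
    ring
  refine Fan.compl_coStar_subset hF α fun hmem => ?_
  have hmem' := Fan.smul_mem_coStar (inv_nonneg.2 hf0.le) hmem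
  have hgrad : f⁻¹ • gradient (softPotential v δ) u =
      ∑ i, w i • v i + ((δ * H) • gradient smoothNorm u + (δ * f⁻¹) • u) := by
    rw [gradient_softPotential hδ, smul_add, smul_smul, inv_mul_cancel₀ hf0.ne', one_smul, add_assoc,
      smul_smul, mul_comm f⁻¹]
  have hdist : Metric.infDist (∑ i, w i • v i) (F.coStar α) ≤ δ * (N + r⁻¹) := by
    refine (Metric.infDist_le_dist_of_mem hmem').trans ?_
    rw [hgrad, dist_self_add_right]
    have h1 : ‖(δ * H) • gradient (smoothNorm : Euc n → ℝ) u‖ ≤ δ * N := by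
      rw [norm_smul, Real.norm_of_nonneg (by positivity)]
      calc δ * H * ‖gradient (smoothNorm : Euc n → ℝ) u‖ ≤ δ * H * 1 :=
            mul_le_mul_of_nonneg_left (norm_gradient_smoothNorm_le u) (by positivity)
        _ ≤ δ * N := by rw [mul_one]; exact mul_le_mul_of_nonneg_left hHN hδ.le
    have h2 : ‖(δ * f⁻¹) • u‖ ≤ δ * r⁻¹ := by
      rw [norm_smul, Real.norm_of_nonneg (by positivity), mul_assoc]
      refine mul_le_mul_of_nonneg_left ?_ hδ.le
      rw [inv_mul_le_iff₀ hf0, ← div_eq_mul_inv, le_div_iff₀ hr]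
      linarith
    calc _ ≤ _ := norm_add_le _ _
      _ ≤ δ * (N + r⁻¹) := by linarith
  have hδH : δ * H ≤ δ * N := mul_le_mul_of_nonneg_left hHN hδ.le
  have hd' : m ≤ δ * H + Metric.infDist (∑ i, w i • v i) (F.coStar α) := hsum ▸ hd
  linarith

end Chambers

/-! ### The monomial division -/

section Division

variable {n : ℕ}

theorem coeff_superpotential (F : Fan n) (c : (Fin n → ℤ) → ℂ) {α : Fin n → ℤ} (hα : α ∈ F.gens) :
    (superpotential F c).coeff α = c α := by
  classical
  rw [superpotential, AddMonoidAlgebra.coeff_sum, Finsupp.finsetSum_apply]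
  simp [AddMonoidAlgebra.coeff_single, Finsupp.single_apply, hα]

theorem support_superpotential (F : Fan n) {c : (Fin n → ℤ) → ℂ} (hc : ∀ α ∈ F.gens, c α ≠ 0) :
    (superpotential F c).coeff.support = F.gens := by
  classical
  ext α
  rw [Finsupp.mem_support_iff]
  by_cases hα : α ∈ F.gens
  · simp [coeff_superpotential F c hα, hα, hc α hα]
  · rw [superpotential, AddMonoidAlgebra.coeff_sum, Finsupp.finsetSum_apply]
    simp [AddMonoidAlgebra.coeff_single, Finsupp.single_apply, hα]

theorem norm_monomial {z : Fin n → ℂ} (hz : z ∈ torus n) (α : Fin n → ℤ) :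
    ‖monomial α z‖ = Real.exp ⟪latticeVec α, Log z⟫_ℝ := by
  rw [monomial, norm_prod, PiLp.inner_apply, Real.exp_sum]
  refine Finset.prod_congr rfl fun j _ => ?_
  rw [norm_zpow, ← Real.rpow_intCast, Real.rpow_def_of_pos (norm_pos_iff.2 (hz j))]
  simp [latticeVec, Log, mul_comm]

theorem norm_mul_monomial_rpow {c : ℂ} (hc : c ≠ 0) {z : Fin n → ℂ} (hz : z ∈ torus n)
    (α : Fin n → ℤ) (k : ℝ) : ‖c * monomial α z‖ ^ k =
      Real.exp (k * Real.log ‖c‖ + ⟪k • latticeVec α, Log z⟫_ℝ) := by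
  have hc' : 0 < ‖c‖ := norm_pos_iff.2 hc
  rw [norm_mul, norm_monomial hz, Real.rpow_def_of_pos (by positivity),
    Real.log_mul hc'.ne' (Real.exp_pos _).ne', Real.log_exp, real_inner_smul_left]
  ring_nf

/-- The map `Log` is proper on the torus. -/
theorem isCompact_torus_inter_preimage_Log {S : Set (Euc n)} (hS : IsCompact S) :
    IsCompact (torus n ∩ Log ⁻¹' S) := by
  -- The preimage is the image of `S × Tⁿ` under polar coordinates.
  have hT : IsCompact {t : Fin n → ℂ | ∀ j, ‖t j‖ = 1} := by
    have := isCompact_univ_pi fun _ : Fin n => isCompact_sphere (0 : ℂ) 1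
    convert this using 1
    ext t
    simp
  have hcont : Continuous fun x : Euc n × (Fin n → ℂ) =>
      fun j => (Real.exp (x.1 j) : ℂ) * x.2 j := by
    fun_prop
  convert (hS.prod hT).image hcont using 1
  ext z
  constructor
  · rintro ⟨hz, hzS⟩
    refine ⟨(Log z, fun j => z j / ‖z j‖), ⟨hzS, fun j => ?_⟩, ?_⟩
    · have := norm_ne_zero_iff.2 (hz j)
      simp [this]
    · funext j
      have h1 : 0 < ‖z j‖ := norm_pos_iff.2 (hz j)
      have h2 : (‖z j‖ : ℂ) ≠ 0 := by exact_mod_cast h1.ne'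
      simp only [Log, Real.exp_log h1]
      field_simp
  · rintro ⟨⟨u, t⟩, ⟨hu, ht⟩, rfl⟩
    have ht' : ∀ j, ‖t j‖ = 1 := ht
    have hz : (fun j => (Real.exp (u j) : ℂ) * t j) ∈ torus n := fun j =>
      mul_ne_zero (by simp [Complex.exp_ne_zero]) (norm_ne_zero_iff.1 (by rw [ht' j]; simp))
    refine ⟨hz, ?_⟩
    have : Log (fun j => (Real.exp (u j) : ℂ) * t j) = u := by
      ext j
      simp [Log, ht' j, Complex.norm_exp]
    change Log (fun j => (Real.exp (u j) : ℂ) * t j) ∈ S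
    rwa [this]

/-- For the gradient of `softPotential` the pieces where a given monomial dominates, compared with the
exponents `k α = 1 / b α`, form a division adapted to the fan. -/
theorem exists_adapted_division {F : Fan n} [Nonempty F.gens] {b : F.gens → ℝ}
    (hb : ∀ i, 0 < b i) (hpos : ∀ u : Euc n, u ≠ 0 → ∃ i, 0 < ⟪(b i)⁻¹ • latticeVec i.1, u⟫_ℝ)
    {δ : ℝ} (hδ : 0 < δ)
    (hstar : ∀ (α : F.gens) (u : Euc n), 2 ≤ ‖u‖ →
      (∀ i, ⟪(b i)⁻¹ • latticeVec i.1, u⟫_ℝ ≤ ⟪(b α)⁻¹ • latticeVec α.1, u⟫_ℝ + δ * ‖u‖) →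
      gradient (softPotential (fun i : F.gens => (b i)⁻¹ • latticeVec i.1) δ) u ∈
        interior (F.star α))
    {c : (Fin n → ℤ) → ℂ} (hc : ∀ α ∈ F.gens, c α ≠ 0) :
    ∃ C : (Fin n → ℤ) → Set (Euc n),
      IsMonomialDivision (superpotential F c)
        (momentMap (softPotential (fun i : F.gens => (b i)⁻¹ • latticeVec i.1) δ)) C ∧
      IsAdapted F
        (momentMap (softPotential (fun i : F.gens => (b i)⁻¹ • latticeVec i.1) δ)) C := by
  classical
  set φ := softPotential (fun i : F.gens => (b i)⁻¹ • latticeVec i.1) δ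
  have hφ : ContDiff ℝ ((⊤ : ℕ∞) : WithTop ℕ∞) φ := contDiff_softPotential hδ
  have hbij : Function.Bijective (gradient φ) := (isRadialPotential_softPotential hδ hpos).bijective
  have hclosed : IsClosedMap (gradient φ) :=
    StrongConvexOn.isClosedMap_gradient (strongConvexOn_softPotential hδ hpos)
      (hφ.differentiable (by simp)) hδ (contDiff_infty.1 hφ 1)
  set k : (Fin n → ℤ) → ℝ := fun α => if h : α ∈ F.gens then (b ⟨α, h⟩)⁻¹ else 1
  have hk : ∀ i : F.gens, k i.1 = (b i)⁻¹ := fun i => dif_pos i.2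
  set s : (Fin n → ℤ) → ℝ := fun α => k α * Real.log ‖c α‖
  -- The logarithm of the `k α`-th power of the absolute value of the term of exponent `α`.
  set level : (Fin n → ℤ) → Euc n → ℝ := fun α u => s α + ⟪k α • latticeVec α, u⟫_ℝ
  have hlevel : ∀ α ∈ F.gens, ∀ z ∈ torus n,
      ‖(superpotential F c).coeff α * monomial α z‖ ^ k α = Real.exp (level α (Log z)) :=
    fun α hα z hz => by
      rw [coeff_superpotential F c hα, norm_mul_monomial_rpow (hc α hα) hz]
  set D : (Fin n → ℤ) → Set (Euc n) := fun α => {u | ∀ β ∈ F.gens, level β u ≤ level α u}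
  have hD : ∀ α, IsClosed (D α) := fun α => by
    have : D α = ⋂ β ∈ F.gens, {u | level β u ≤ level α u} := by
      ext u
      simp [D]
    rw [this]
    exact isClosed_biInter fun β _ => isClosed_le (by fun_prop) (by fun_prop)
  have hmax : ∀ u, ∃ α ∈ F.gens, u ∈ D α := fun u => by
    obtain ⟨i⟩ := ‹Nonempty F.gens›
    obtain ⟨α, hα, h⟩ := F.gens.exists_max_image (fun α => level α u) ⟨i.1, i.2⟩
    exact ⟨α, hα, h⟩
  have hmem : ∀ α z, momentMap φ z ∈ gradient φ '' D α ↔ Log z ∈ D α := fun α z =>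
    hbij.1.mem_set_image
  refine ⟨fun α => gradient φ '' D α, ⟨?_, ?_, ?_⟩, ?_⟩
  · exact fun α _ => hclosed _ (hD α)
  · refine ⟨∅, isCompact_empty, fun x _ => ?_⟩
    obtain ⟨u, rfl⟩ := hbij.2 x
    obtain ⟨α, hα, h⟩ := hmax u
    exact ⟨α, by rwa [support_superpotential F hc], u, h, rfl⟩
  · rw [support_superpotential F hc]
    refine ⟨k, fun α hα => ?_, fun z hz => ?_⟩
    · rw [hk ⟨α, hα⟩]
      exact inv_pos.2 (hb _)
    · obtain ⟨α, hα, h⟩ := hmax (Log z)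
      refine ⟨α, hα, (hmem α z).2 h, fun β hβ => ?_⟩
      rw [hlevel β hβ z hz, hlevel α hα z hz]
      exact Real.exp_le_exp.2 (h β hβ)
  · intro α hα
    -- Outside the ball of radius `R` the constants `s β` are negligible compared with `δ ‖u‖`.
    set R : ℝ := max 2 ((s α + ∑ β ∈ F.gens, |s β|) / δ)
    refine ⟨torus n ∩ Log ⁻¹' (D α ∩ Metric.closedBall 0 R),
      isCompact_torus_inter_preimage_Log ((isCompact_closedBall 0 R).inter_left (hD α)),
      fun z hz => ⟨hz.1, (hmem α z).2 hz.2.1⟩, ?_⟩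
    rintro _ ⟨z, ⟨⟨hz, hzC⟩, hzK⟩, rfl⟩
    have hzD : Log z ∈ D α := (hmem α z).1 hzC
    have hR : R < ‖Log z‖ := by
      by_contra hle
      exact hzK ⟨hz, hzD, mem_closedBall_zero_iff.2 (not_lt.1 hle)⟩
    obtain ⟨h2, hs⟩ := max_lt_iff.1 hR
    rw [div_lt_iff₀ hδ] at hs
    refine hstar ⟨α, hα⟩ (Log z) h2.le fun i => ?_
    have h1 := hzD i.1 i.2
    simp only [level] at h1
    rw [hk i, hk ⟨α, hα⟩] at h1
    have h3 : |s i.1| ≤ ∑ β ∈ F.gens, |s β| :=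
      Finset.single_le_sum (f := fun β => |s β|) (fun β _ => abs_nonneg _) i.2
    have h4 := neg_abs_le (s i.1)
    linarith

end Division

end ToricMirror

end

theorem mainTheorem7 (n : ℕ) (hn : 1 ≤ n) (F : ToricMirror.Fan n) (hF : F.IsProjective) :
    ∃ (ω : ToricMirror.TwoForm n) (φ : ToricMirror.Euc n → ℝ),
      ToricMirror.IsRadialWith ω φ ∧
      ToricMirror.IsMomentMap ω (ToricMirror.momentMap φ) ∧
      ∀ c : (Fin n → ℤ) → ℂ, (∀ α ∈ F.gens, c α ≠ 0) →
        ∃ C : (Fin n → ℤ) → Set (ToricMirror.Euc n),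
          ToricMirror.IsMonomialDivision (ToricMirror.superpotential F c)
            (ToricMirror.momentMap φ) C ∧
          ToricMirror.IsAdapted F (ToricMirror.momentMap φ) C := by
  obtain ⟨b, hb, hpos, hcone⟩ := hF.exists_supports
  have hne : Nonempty F.gens := by
    obtain ⟨i, _⟩ := hpos (EuclideanSpace.single ⟨0, hn⟩ 1) (by simp)
    exact ⟨i⟩
  have hev := Filter.eventually_all.2 fun α : F.gens =>
    hF.eventually_gradient_mem_star hb hpos hcone α
  obtain ⟨δ, hstar, hδ⟩ := (hev.and self_mem_nhdsWithin).exists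
  set φ := ToricMirror.softPotential
    (fun i : F.gens => (b i)⁻¹ • ToricMirror.latticeVec i.1) δ
  have hφ : ContDiff ℝ ((⊤ : ℕ∞) : WithTop ℕ∞) φ := ToricMirror.contDiff_softPotential hδ
  refine ⟨ToricMirror.kahlerForm φ, φ, ⟨?_, ?_, fun _ _ => rfl⟩, ?_, fun c hc => ?_⟩
  · refine ToricMirror.isToricKahlerForm_kahlerForm hφ fun u x hx => ?_
    exact lt_of_lt_of_le (by positivity) (ToricMirror.le_hessian_softPotential hδ hpos u x)
  · exact ToricMirror.isRadialPotential_softPotential hδ hpos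
  · exact ToricMirror.isMomentMap_momentMap hφ
  · exact ToricMirror.exists_adapted_division hb hpos hδ hstar hc
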